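/- **Setting.** Simple types are $\sigma,\tau ::= o \mid \sigma\to\tau$. Fix a ranked alphabet $\Sigma$ and an alternating parity tree automaton $\mathcal A$ over $\Sigma$ with finite set of states $Q$, transition function $\delta$ (each $\delta(q,a)$, for $a\in\Sigma$ of arity $n$, is a finite disjunction of conjunctive clauses, i.e. of finite sets of pairs in $\{1,\dots,n\}\times Q$) and colouring $\Omega:Q\to\mathbb N$. Let $Col=\Omega(Q)\uplus\{\epsilon\}$, where $\epsilon$ is a new least element, neutral for $\max$. The simply typed $\lambda Y$-terms are generated by variables, constants $a\in\Sigma$ of arity $n$ (of type $o\to\cdots\to o\to o$ with $n$ arguments), abstraction, application, and $Y_\sigma M::\sigma$ for $M::\sigma\to\sigma$. An infinite sequence of colours is *winning* if some element of $Col\setminus\{\epsilon\}$ occurs infinitely often in it and the greatest such element is even. A coloured tree is winning if all its infinite branches are. **The coloured Scott model.** $\mathbf{ScottL}$ is the category of preorders and downward-closed relations ($(a,b)\in R$, $a\le a'$, $b'\le b$ imply $(a',b')\in R$), with relational composition, $A\otimes B=A\times B$, $A\multimap B=A^{op}\times B$ and product $A\mathbin{\&}B=A\uplus B$. For a preorder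 $A$, let $\square A=Col\times A$ with $(c,a)\le(c',a')$ iff $c=c'$ and $a\le a'$; let $!A$ be the set of finite subsets of $A$, with $u\le v$ iff every element of $u$ is below an element of $v$; and let $\dagger A={!}\square A$. With counit $\{(u,a)\mid\exists(\epsilon,a')\in u,\ a\le a'\}$ and the comultiplication composed from $\{(u,U)\mid\forall w\in U,\ w\le u\}:{!}A\to{!!}A$, $\{((\max(c_1,c_2),a),(c_1,(c_2,a')))\mid a'\le a\}:\square A\to\square\square A$ and the distributive law $\{(w,(c,v))\mid\forall a\in v\ \exists(c,a')\in w,\ a\le a'\}:{!}\square A\to\square{!}A$, $\dagger$ is a comonad satisfying the Seely axioms; its Kleisli category is cartesian closed. Put $[\![o]\!]=(Q,=)$ and $[\![\sigma\to\tau]\!]=\dagger[\![\sigma]\!]\multimap[\![\tau]\!]$. A term $t::\tau$ in context $x_1::\sigma_1,\dots,x_n::\sigma_n$ is interpreted in this Kleisli category as a downward-closed relation $$[\![\Gamma\vdash t::\tau]\!]\subseteq(\dagger[\![\sigma_1]\!]\otimes\cdots\otimes\dagger[\![\sigma_n]\!])\multimap[\![\tau]\!],$$ where the variables, abstraction and application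 are interpreted by the cartesian closed structure, and the constants and $Y$ as follows. * A constant $a$ of arity $n$ is interpreted by the set of all $(\alpha_1,\dots,\alpha_n,q)$ such that $(\alpha_1,\dots,\alpha_n)$ *satisfies* $\delta(q,a)$: there are $J_k\subseteq\alpha_k$ such that $\{(k,q')\mid \exists c,\ (c,q')\in J_k\}$ is a conjunctive clause of $\delta(q,a)$ and $c=\Omega(q')$ for all $(c,q')\in J_k$. * $Y_\sigma M$ is interpreted by $\mathbf Y(R)$, where $R:\dagger X\otimes\dagger A\to A$ is the uncurried interpretation of $M$, $A=[\![\sigma]\!]$ and $X=[\![\sigma_1]\!]\mathbin{\&}\cdots\mathbin{\&}[\![\sigma_n]\!]$ (so that $\dagger X\cong\dagger[\![\sigma_1]\!]\otimes\cdots\otimes\dagger[\![\sigma_n]\!]$). Here $(u,a)\in\mathbf Y(R)$ iff there is a winning semantic run-tree of $R$ producing $a$ whose set of leaves is $u$. A *semantic run-tree* of $R$ producing $a$ is a finitely branching, possibly infinite $(X\uplus A)$-labelled tree with nodes coloured in $Col$, whose root has label $a$ and colour $\epsilon$, whose nodes labelled in $X$ are leaves, and such that $(w,v,b)\in R$ for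 each node labelled by $b\in A$, where $w$ and $v$ are the sets of pairs (colour, label) of its children labelled in $X$ and in $A$ respectively (both are empty if the node is a leaf). Its *set of leaves* consists of the pairs $(c,x)$ such that some leaf is labelled by $x\in X$ and $c$ is the greatest colour on the path from this leaf to the root, both included. **The type system.** Sequents are $\Gamma=x_1:u_1::\sigma_1,\dots,x_n:u_n::\sigma_n\vdash t:\alpha::\tau$ with $u_i\in\dagger[\![\sigma_i]\!]$ and $\alpha\in[\![\tau]\!]$. Write $u\to\alpha$ for $(u,\alpha)\in[\![\sigma\to\tau]\!]$; let $\square_c\Gamma$ replace each $(d,\beta)$ occurring in $\Gamma$ by $(\max(c,d),\beta)$, and let $\cup$ be the componentwise union of contexts. The rules are: * (Ax) $\Gamma\vdash x:\alpha$, if $x:u$ is in $\Gamma$ and there is $(\epsilon,\alpha')\in u$ with $\alpha\le\alpha'$; * ($\delta$) $\Gamma\vdash a:\alpha_1\to\cdots\to\alpha_n\to q$, if $(\alpha_1,\dots,\alpha_n)$ satisfies $\delta(q,a)$; * ($\lambda$) from $\Gamma,x:u\vdash M:\alpha$ infer $\Gamma\vdash\lambda x.M:u\to\alpha$; * (App)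 from $\Gamma_0\vdash M:\{(c_1,\beta_1),\dots,(c_m,\beta_m)\}\to\alpha$ and $\Gamma_i\vdash N:\beta_i$ for $1\le i\le m$ infer $\Gamma_0\cup\square_{c_1}\Gamma_1\cup\dots\cup\square_{c_m}\Gamma_m\vdash M\,N:\alpha$; * ($Y_\sigma$) from $\Gamma_0\vdash M:\{(c_1,\beta_1),\dots,(c_m,\beta_m)\}\to\alpha$ and $\Gamma_i\vdash Y_\sigma M:\beta_i$ for $1\le i\le m$ infer $\Gamma_0\cup\square_{c_1}\Gamma_1\cup\dots\cup\square_{c_m}\Gamma_m\vdash Y_\sigma M:\alpha$. Derivation trees may be infinite. In an instance of ($Y_\sigma$) the premise $\Gamma_i\vdash Y_\sigma M:\beta_i$ has colour $c_i$; all other nodes have colour $\epsilon$. **Theorem.** For every $\lambda Y$-term $t::\tau$ in context $x_1::\sigma_1,\dots,x_n::\sigma_n$, all $u_i\in\dagger[\![\sigma_i]\!]$ and all $\alpha\in[\![\tau]\!]$, the sequent $$x_1:u_1::\sigma_1,\dots,x_n:u_n::\sigma_n\vdash t:\alpha::\tau$$ has a winning derivation tree if and only if $$(u_1,\dots,u_n,\alpha)\in[\![\Gamma\vdash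 t::\tau]\!].$$ -/

import Mathlib

universe u v

namespace ColScott

/-! ### Simple types and the simply typed λY-calculus over a ranked alphabet -/

/-- Simple types `σ, τ ::= o | σ → τ`. -/
inductive Ty : Type
  | o : Ty
  | arr : Ty → Ty → Ty

/-- The type `o → ⋯ → o → o` with `n` arguments, i.e. the type of a constructor of arity `n`. -/
def Ty.ofArity : ℕ → Ty
  | 0 => .o
  | n + 1 => .arr .o (Ty.ofArity n)

/-- `Var Γ σ`: the variables of type `σ` declared in the context `Γ`. -/
inductive Var : List Ty → Ty → Type
  | zero {Γ : List Ty} {σ : Ty} : Var (σ :: Γ) σ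
  | succ {Γ : List Ty} {σ τ : Ty} : Var Γ σ → Var (τ :: Γ) σ

/-- Simply typed λY-terms in context, with constants in the ranked alphabet `(Sig, ar)`. -/
inductive Tm {Sig : Type v} (ar : Sig → ℕ) : List Ty → Ty → Type v
  | var {Γ : List Ty} {σ : Ty} : Var Γ σ → Tm ar Γ σ
  | con {Γ : List Ty} (a : Sig) : Tm ar Γ (Ty.ofArity (ar a))
  | lam {Γ : List Ty} {σ τ : Ty} : Tm ar (σ :: Γ) τ → Tm ar Γ (.arr σ τ)
  | app {Γ : List Ty} {σ τ : Ty} : Tm ar Γ (.arr σ τ) → Tm ar Γ σ → Tm ar Γ τ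
  | fix {Γ : List Ty} {σ : Ty} : Tm ar Γ (.arr σ σ) → Tm ar Γ σ

/-! ### Preorders and downward-closed relations -/

/-- Objects of the category `ScottL`: preorders. -/
structure Obj : Type (u + 1) where
  carrier : Type u
  le : carrier → carrier → Prop
  refl : ∀ a, le a a
  trans : ∀ {a b c}, le a b → le b c → le a c

/-- Morphisms of `ScottL`: downward-closed relations. -/
@[ext]
structure Mor (A B : Obj.{u}) where
  rel : A.carrier → B.carrier → Prop
  closed : ∀ {a a' b b'}, rel a b → A.le a a' → B.le b' b → rel a' b'

/-- Identity of `ScottL`. -/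
def Mor.id (A : Obj.{u}) : Mor A A where
  rel a' a := A.le a a'
  closed h h₁ h₂ := A.trans h₂ (A.trans h h₁)

/-- Relational composition, in diagrammatic order. -/
def Mor.comp {A B C : Obj.{u}} (R : Mor A B) (S : Mor B C) : Mor A C where
  rel a c := ∃ b, R.rel a b ∧ S.rel b c
  closed := by
    rintro a a' c c' ⟨b, h₁, h₂⟩ ha hc
    exact ⟨b, R.closed h₁ ha (B.refl b), S.closed h₂ (B.refl b) hc⟩

/-- The tensor product. -/
abbrev Obj.tensor (A B : Obj.{u}) : Obj.{u} where
  carrier := A.carrier × B.carrier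
  le p q := A.le p.1 q.1 ∧ B.le p.2 q.2
  refl _ := ⟨A.refl _, B.refl _⟩
  trans h h' := ⟨A.trans h.1 h'.1, B.trans h.2 h'.2⟩

def Mor.tensor {A B C D : Obj.{u}} (R : Mor A B) (S : Mor C D) :
    Mor (A.tensor C) (B.tensor D) where
  rel p q := R.rel p.1 q.1 ∧ S.rel p.2 q.2
  closed h h₁ h₂ := ⟨R.closed h.1 h₁.1 h₂.1, S.closed h.2 h₁.2 h₂.2⟩

/-- The linear arrow `A ⊸ B`, i.e. `Aᵒᵖ × B`. -/
abbrev Obj.lolli (A B : Obj.{u}) : Obj.{u} where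
  carrier := A.carrier × B.carrier
  le p q := A.le q.1 p.1 ∧ B.le p.2 q.2
  refl _ := ⟨A.refl _, B.refl _⟩
  trans h h' := ⟨A.trans h'.1 h.1, B.trans h.2 h'.2⟩

/-- Evaluation `(A ⊸ B) ⊗ A → B`. -/
def Mor.ev (A B : Obj.{u}) : Mor ((A.lolli B).tensor A) B where
  rel p b := A.le p.1.1 p.2 ∧ B.le b p.1.2
  closed h h₁ h₂ := ⟨A.trans h₁.1.1 (A.trans h.1 h₁.2), B.trans h₂ (B.trans h.2 h₁.1.2)⟩

/-- Linear currying. -/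
def Mor.curry {A B C : Obj.{u}} (R : Mor (A.tensor B) C) : Mor A (B.lolli C) where
  rel a p := R.rel (a, p.1) p.2
  closed h h₁ h₂ := R.closed h ⟨h₁, h₂.1⟩ h₂.2

/-- Linear uncurrying. -/
def Mor.uncurry {A B C : Obj.{u}} (R : Mor A (B.lolli C)) : Mor (A.tensor B) C where
  rel p c := R.rel p.1 (p.2, c)
  closed h h₁ h₂ := R.closed h h₁.1 ⟨h₁.2, h₂⟩

/-- The cartesian product `A & B`: disjoint union of preorders. -/
abbrev Obj.prod (A B : Obj.{u}) : Obj.{u} where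
  carrier := A.carrier ⊕ B.carrier
  le := Sum.LiftRel A.le B.le
  refl
    | .inl a => .inl (A.refl a)
    | .inr b => .inr (B.refl b)
  trans
    | .inl h, .inl h' => .inl (A.trans h h')
    | .inr h, .inr h' => .inr (B.trans h h')

/-- The terminal object `⊤`: the empty preorder. -/
abbrev Obj.top : Obj.{u} where
  carrier := PEmpty
  le _ _ := True
  refl _ := trivial
  trans _ _ := trivial

/-! ### The exponential `!` -/

/-- `!A`: finite subsets, `u ≤ v` iff every element of `u` is below some element of `v`. -/
abbrev Obj.bang (A : Obj.{u}) : Obj.{u} where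
  carrier := Finset A.carrier
  le u v := ∀ a ∈ u, ∃ b ∈ v, A.le a b
  refl u a ha := ⟨a, ha, A.refl a⟩
  trans h h' a ha := by
    obtain ⟨b, hb, hab⟩ := h a ha
    obtain ⟨c, hc, hbc⟩ := h' b hb
    exact ⟨c, hc, A.trans hab hbc⟩

/-- Functorial action of `!`. -/
def Mor.bang {A B : Obj.{u}} (R : Mor A B) : Mor A.bang B.bang where
  rel u v := ∀ b ∈ v, ∃ a ∈ u, R.rel a b
  closed := by
    intro u u' v v' h hu hv b hb
    obtain ⟨b₁, hb₁, hle⟩ := hv b hb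
    obtain ⟨a, ha, hR⟩ := h b₁ hb₁
    obtain ⟨a', ha', hle'⟩ := hu a ha
    exact ⟨a', ha', R.closed hR hle' hle⟩

/-- Counit of `!`. -/
def Mor.bangDer (A : Obj.{u}) : Mor A.bang A where
  rel u a := ∃ a' ∈ u, A.le a a'
  closed := by
    rintro u u' a b ⟨a', ha', h⟩ hu hb
    obtain ⟨a'', ha'', h'⟩ := hu a' ha'
    exact ⟨a'', ha'', A.trans hb (A.trans h h')⟩

/-- Comultiplication of `!`. -/
def Mor.bangDig (A : Obj.{u}) : Mor A.bang A.bang.bang where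
  rel u U := ∀ w ∈ U, A.bang.le w u
  closed := by
    intro u u' U U' h hu hU w hw
    obtain ⟨w', hw', hle⟩ := hU w hw
    exact A.bang.trans hle (A.bang.trans (h w' hw') hu)

/-! ### The colouring comonad `□` and the coloured exponential `!□`

The colours range over a linear order `C` whose least element `⊥` is the neutral colour `ε`. -/

section Colour

variable (C : Type) [LinearOrder C] [OrderBot C]

/-- `□A`: the `C`-fold product `A & ⋯ & A`. -/
abbrev Obj.box (A : Obj.{u}) : Obj.{u} where
  carrier := C × A.carrier
  le p q := p.1 = q.1 ∧ A.le p.2 q.2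
  refl _ := ⟨rfl, A.refl _⟩
  trans h h' := ⟨h.1.trans h'.1, A.trans h.2 h'.2⟩

/-- Functorial action of `□`. -/
def Mor.box {A B : Obj.{u}} (R : Mor A B) : Mor (A.box C) (B.box C) where
  rel p q := p.1 = q.1 ∧ R.rel p.2 q.2
  closed h h₁ h₂ := ⟨h₁.1.symm.trans (h.1.trans h₂.1.symm), R.closed h.2 h₁.2 h₂.2⟩

/-- Counit of `□`. -/
def Mor.boxDer (A : Obj.{u}) : Mor (A.box C) A where
  rel p a := p.1 = ⊥ ∧ A.le a p.2
  closed h h₁ h₂ := ⟨h₁.1.symm.trans h.1, A.trans h₂ (A.trans h.2 h₁.2)⟩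

/-- Comultiplication of `□`. -/
def Mor.boxDig (A : Obj.{u}) : Mor (A.box C) ((A.box C).box C) where
  rel p q := p.1 = max q.1 q.2.1 ∧ A.le q.2.2 p.2
  closed := by
    rintro a a' b b' ⟨h, h'⟩ ⟨h₁, h₁'⟩ ⟨h₂, h₂', h₂''⟩
    exact ⟨by rw [← h₁, h, h₂, h₂'], A.trans h₂'' (A.trans h' h₁')⟩

/-- The distributive law `!□ ⇒ □!`. -/
def Mor.dist (A : Obj.{u}) : Mor (A.box C).bang (A.bang.box C) where
  rel w p := ∀ a ∈ p.2, ∃ e ∈ w, p.1 = e.1 ∧ A.le a e.2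
  closed := by
    rintro w w' p p' h hw ⟨hc, hp⟩ a ha
    obtain ⟨a₁, ha₁, hle₁⟩ := hp a ha
    obtain ⟨e, he, hce, hle⟩ := h a₁ ha₁
    obtain ⟨e', he', hce', hle'⟩ := hw e he
    exact ⟨e', he', hc.trans (hce.trans hce'), A.trans hle₁ (A.trans hle hle')⟩

/-- The coloured exponential `!□A`. -/
abbrev Obj.cbang (A : Obj.{u}) : Obj.{u} := (A.box C).bang

/-- Functorial action of the coloured exponential. -/
def Mor.cbang {A B : Obj.{u}} (R : Mor A B) : Mor (A.cbang C) (B.cbang C) := (R.box C).bang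

/-- Counit of the coloured exponential. -/
def Mor.der (A : Obj.{u}) : Mor (A.cbang C) A := (Mor.bangDer (A.box C)).comp (Mor.boxDer C A)

/-- Comultiplication `!□ → !!□ → !!□□ → !□!□` of the coloured exponential. -/
def Mor.dig (A : Obj.{u}) : Mor (A.cbang C) ((A.cbang C).cbang C) :=
  ((Mor.bangDig (A.box C)).comp (Mor.boxDig C A).bang.bang).comp (Mor.dist C (A.box C)).bang

/-- Contraction `!□A → !□A ⊗ !□A`. -/
def Mor.contr (A : Obj.{u}) : Mor (A.cbang C) ((A.cbang C).tensor (A.cbang C)) where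
  rel w p := (A.cbang C).le p.1 w ∧ (A.cbang C).le p.2 w
  closed h h₁ h₂ :=
    ⟨Obj.trans _ h₂.1 (Obj.trans _ h.1 h₁), Obj.trans _ h₂.2 (Obj.trans _ h.2 h₁)⟩

/-- The Seely isomorphism `!□A ⊗ !□B → !□(A & B)`. -/
def Mor.seely (A B : Obj.{u}) : Mor ((A.cbang C).tensor (B.cbang C)) ((A.prod B).cbang C) where
  rel p w :=
    (∀ c a, (c, Sum.inl a) ∈ w → ∃ a', (c, a') ∈ p.1 ∧ A.le a a') ∧
    (∀ c b, (c, Sum.inr b) ∈ w → ∃ b', (c, b') ∈ p.2 ∧ B.le b b')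
  closed := by
    rintro p p' w w' ⟨hA, hB⟩ ⟨h₁, h₂⟩ hw
    constructor
    · intro c a ha
      obtain ⟨⟨c₁, e⟩, he, hc, hle⟩ := hw _ ha
      obtain rfl : c = c₁ := hc
      cases hle with
      | inl hle =>
        obtain ⟨a₂, ha₂, hle₂⟩ := hA _ _ he
        obtain ⟨⟨c₃, a₃⟩, ha₃, hc₃, hle₃⟩ := h₁ _ ha₂
        obtain rfl : c = c₃ := hc₃
        exact ⟨a₃, ha₃, A.trans hle (A.trans hle₂ hle₃)⟩
    · intro c b hb
      obtain ⟨⟨c₁, e⟩, he, hc, hle⟩ := hw _ hb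
      obtain rfl : c = c₁ := hc
      cases hle with
      | inr hle =>
        obtain ⟨a₂, ha₂, hle₂⟩ := hB _ _ he
        obtain ⟨⟨c₃, a₃⟩, ha₃, hc₃, hle₃⟩ := h₂ _ ha₂
        obtain rfl : c = c₃ := hc₃
        exact ⟨a₃, ha₃, B.trans hle (B.trans hle₂ hle₃)⟩

end Colour

/-! ### Coloured trees

A (finitely branching, possibly infinite) coloured tree is given by its nodes: `t p` is the colour
and label of the node at address `p` (the list of child indices read from the root), and `none` if
there is no such node. -/

section Trees

variable {C : Type} [LinearOrder C] [OrderBot C]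

/-- The tree `t` has a root, and for every node, the list of its coloured children is allowed by
`step` below the label of that node. -/
structure IsTree {L : Type u} (step : L → List (C × L) → Prop) (root : C × L)
    (t : List ℕ → Option (C × L)) : Prop where
  root_eq : t [] = some root
  children : ∀ p c x, t p = some (c, x) →
    ∃ cs : List (C × L), step x cs ∧ ∀ k, t (p ++ [k]) = cs[k]?
  none_of_none : ∀ p k, t p = none → t (p ++ [k]) = none

/-- Colour of the node at address `p` (junk value `⊥` if there is no such node). -/
def colourAt {L : Type u} (t : List ℕ → Option (C × L)) (p : List ℕ) : C :=
  (t p).elim ⊥ Prod.fst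

/-- Maximal colour on the path from the root to the node at address `p`, both included. -/
def pathColour {L : Type u} (t : List ℕ → Option (C × L)) (p : List ℕ) : C :=
  (Finset.range (p.length + 1)).sup fun i => colourAt t (p.take i)

/-- The address of the `n`-th node on the branch which follows the child indices `f`. -/
def prefixAt (f : ℕ → ℕ) (n : ℕ) : List ℕ := (List.range n).map f

/-- A tree is winning if all its infinite branches have a winning sequence of colours. -/
def TreeWins {L : Type u} (win : (ℕ → C) → Prop) (t : List ℕ → Option (C × L)) : Prop :=
  ∀ f : ℕ → ℕ, (∀ n, t (prefixAt f n) ≠ none) → win fun n => colourAt t (prefixAt f n)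

/-- Local condition on semantic run-trees of `R : !□X ⊗ !□A → A`: a node labelled in `X` is a leaf,
and at a node labelled `b ∈ A`, the sets of coloured labels of the children in `X` and in `A`
are related to `b` by `R` (for a leaf, both sets are empty). -/
def runStep {X A : Obj.{u}} (R : Mor ((X.cbang C).tensor (A.cbang C)) A) :
    X.carrier ⊕ A.carrier → List (C × (X.carrier ⊕ A.carrier)) → Prop
  | .inl _, cs => cs = []
  | .inr b, cs => ∃ (w : Finset (C × X.carrier)) (v : Finset (C × A.carrier)),
      (∀ c x, (c, x) ∈ w ↔ (c, Sum.inl x) ∈ cs) ∧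
      (∀ c a, (c, a) ∈ v ↔ (c, Sum.inr a) ∈ cs) ∧ R.rel (w, v) b

/-- Semantic run-trees of `R` producing `a`. -/
def IsRunTree {X A : Obj.{u}} (R : Mor ((X.cbang C).tensor (A.cbang C)) A) (a : A.carrier)
    (t : List ℕ → Option (C × (X.carrier ⊕ A.carrier))) : Prop :=
  IsTree (runStep R) (⊥, Sum.inr a) t

/-- The elements of `X` at the leaves, coloured by the maximal colour on the path to the root. -/
def leaves {X A : Type u} (t : List ℕ → Option (C × (X ⊕ A))) : Set (C × X) :=
  {e | ∃ p c', t p = some (c', Sum.inl e.2) ∧ e.1 = pathColour t p}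

/-- The underlying relation of the fixpoint of `R`. -/
def fixRel (win : (ℕ → C) → Prop) {X A : Obj.{u}} (R : Mor ((X.cbang C).tensor (A.cbang C)) A)
    (w : Finset (C × X.carrier)) (a : A.carrier) : Prop :=
  ∃ t : List ℕ → Option (C × (X.carrier ⊕ A.carrier)),
    IsRunTree R a t ∧ TreeWins win t ∧ ∀ e, e ∈ w ↔ e ∈ leaves t

theorem fixRel_closed (win : (ℕ → C) → Prop) {X A : Obj.{u}}
    (R : Mor ((X.cbang C).tensor (A.cbang C)) A) {w w' : Finset (C × X.carrier)}
    {a a' : A.carrier} (h : fixRel win R w a) (hw : (X.cbang C).le w w') (ha : A.le a' a) :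
    fixRel win R w' a' := by
  obtain ⟨t, ht, hwin, hleaves⟩ := h
  obtain ⟨cs₀, hstep₀, hcs₀⟩ := ht.children [] ⊥ (.inr a) ht.root_eq
  -- replacement of the leaves
  have hφ : ∀ (c : C) (x : X.carrier), ∃ x' : X.carrier,
      (c, x) ∈ w → X.le x x' ∧ (c, x') ∈ w' := by
    intro c x
    by_cases hx : (c, x) ∈ w
    · obtain ⟨⟨c', x'⟩, hx', hc, hle⟩ := hw _ hx
      obtain rfl : c = c' := hc
      exact ⟨x', fun _ => ⟨hle, hx'⟩⟩
    · exact ⟨x, fun h => absurd h hx⟩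
  choose φ hφ using hφ
  let g : List ℕ → C × (X.carrier ⊕ A.carrier) → C × (X.carrier ⊕ A.carrier) :=
    fun p e => (e.1, Sum.map (φ (pathColour t p)) (fun b => b) e.2)
  let t' : List ℕ → Option (C × (X.carrier ⊕ A.carrier))
    | [] => some (⊥, .inr a')
    | k :: p => if k < cs₀.length then (t (k :: p)).map (g (k :: p)) else
        if p = [] then (w'.toList[k - cs₀.length]?).map (fun e => (e.1, Sum.inl e.2)) else none
  have t'_nil : t' [] = some (⊥, .inr a') := rfl
  have t'_lt : ∀ k p, k < cs₀.length → t' (k :: p) = (t (k :: p)).map (g (k :: p)) :=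
    fun k p hk => if_pos hk
  have t'_ge : ∀ k, ¬ k < cs₀.length →
      t' [k] = (w'.toList[k - cs₀.length]?).map (fun e => (e.1, Sum.inl e.2)) :=
    fun k hk => (if_neg hk).trans (if_pos rfl)
  have t'_none : ∀ k k' p, ¬ k < cs₀.length → t' (k :: k' :: p) = none :=
    fun k k' p hk => (if_neg hk).trans (if_neg (List.cons_ne_nil _ _))
  have hleaf : ∀ p c x, t p = some (c, .inl x) → (pathColour t p, x) ∈ w :=
    fun p c x hp => (hleaves _).2 ⟨p, c, hp, rfl⟩
  -- colours are preserved
  have hcol : ∀ p, (p = [] ∨ ∃ k q, p = k :: q ∧ k < cs₀.length) →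
      colourAt t' p = colourAt t p := by
    rintro p (rfl | ⟨k, q, rfl, hk⟩)
    · simp [colourAt, ht.root_eq, t']
    · simp only [colourAt, t'_lt k q hk]
      cases t (k :: q) <;> rfl
  have htake : ∀ (k : ℕ) (q : List ℕ) (i : ℕ), k < cs₀.length →
      ((k :: q).take i = [] ∨ ∃ k' q', (k :: q).take i = k' :: q' ∧ k' < cs₀.length) := by
    intro k q i hk
    cases i with
    | zero => exact .inl rfl
    | succ i => exact .inr ⟨k, q.take i, rfl, hk⟩
  have hpath : ∀ k q, k < cs₀.length → pathColour t' (k :: q) = pathColour t (k :: q) :=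
    fun k q hk => Finset.sup_congr rfl fun i _ => hcol _ (htake k q i hk)
  -- relabelled children still satisfy the local condition
  have hrel : ∀ (p : List ℕ) (cs cs' : List (C × (X.carrier ⊕ A.carrier)))
      (b b' : A.carrier), (∀ k, t (p ++ [k]) = cs[k]?) → runStep R (.inr b) cs → A.le b' b →
      (∀ c d, (c, Sum.inr d) ∈ cs' ↔ (c, Sum.inr d) ∈ cs) →
      (∀ k c x, cs[k]? = some (c, .inl x) →
        (c, Sum.inl (φ (pathColour t (p ++ [k])) x)) ∈ cs') →
      runStep R (.inr b') cs' := by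
    classical
    rintro p cs cs' b b' hk ⟨w₁, v₁, h₁, h₂, hR⟩ hb hA hX
    refine ⟨(cs'.filterMap fun e => e.2.elim (fun x => some (e.1, x)) fun _ => none).toFinset,
      v₁, ?_, ?_, R.closed hR ⟨?_, Obj.refl _ _⟩ hb⟩
    · intro c x
      simp only [List.mem_toFinset, List.mem_filterMap]
      constructor
      · rintro ⟨⟨c', y⟩, hy, hxy⟩
        cases y with
        | inl y => simp at hxy; obtain ⟨rfl, rfl⟩ := hxy; exact hy
        | inr y => simp at hxy
      · intro hx
        exact ⟨_, hx, rfl⟩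
    · intro c d
      rw [h₂, hA]
    · rintro ⟨c, x⟩ hx
      obtain ⟨k, hk'⟩ := List.mem_iff_getElem?.1 ((h₁ c x).1 hx)
      refine ⟨(c, φ (pathColour t (p ++ [k])) x), ?_, rfl,
        (hφ _ _ (hleaf _ c x ((hk k).trans hk'))).1⟩
      simp only [List.mem_toFinset, List.mem_filterMap]
      exact ⟨_, hX k c x hk', rfl⟩
  refine ⟨t', ⟨rfl, ?_, ?_⟩, ?_, ?_⟩
  · -- local conditions
    intro p c y hp
    cases p with
    | nil =>
      obtain ⟨rfl, rfl⟩ : ⊥ = c ∧ Sum.inr a' = y := by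
        have : some ((⊥ : C), (Sum.inr a' : X.carrier ⊕ A.carrier)) = some (c, y) := hp
        simpa using this
      refine ⟨(cs₀.mapIdx fun k e => g [k] e) ++ w'.toList.map fun e => (e.1, Sum.inl e.2),
        hrel [] cs₀ _ a a' hcs₀ hstep₀ ha ?_ ?_, ?_⟩
      · intro c d
        simp only [List.mem_append, List.mem_map, List.mem_mapIdx]
        constructor
        · rintro (⟨k, hk, hkk⟩ | ⟨e, -, he⟩)
          · rcases hy : cs₀[k] with ⟨c', y⟩
            rw [hy] at hkk
            cases y with
            | inl y => simp [g] at hkk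
            | inr y =>
              simp [g] at hkk
              obtain ⟨rfl, rfl⟩ := hkk
              exact hy ▸ List.getElem_mem hk
          · simp at he
        · intro hd
          obtain ⟨k, hk, hkk⟩ := List.getElem_of_mem hd
          exact .inl ⟨k, hk, by rw [hkk]; rfl⟩
      · intro k c x hk
        obtain ⟨hk', hkk⟩ := List.getElem?_eq_some_iff.1 hk
        simp only [List.mem_append, List.mem_mapIdx]
        exact .inl ⟨k, hk', by rw [hkk]; rfl⟩
      · intro k
        by_cases hk : k < cs₀.length
        · rw [List.getElem?_append_left (by simpa using hk)]
          have := hcs₀ k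
          simp only [List.nil_append] at this ⊢
          rw [t'_lt k [] hk, this]
          simp
        · rw [List.getElem?_append_right (by simpa using hk)]
          simp only [List.nil_append]
          rw [t'_ge k hk]
          simp
    | cons k q =>
      by_cases hk : k < cs₀.length
      · rw [t'_lt k q hk] at hp
        obtain ⟨⟨c₁, y₁⟩, hy₁, hg⟩ := Option.map_eq_some_iff.1 hp
        obtain ⟨cs, hstep, hcs⟩ := ht.children _ _ _ hy₁
        have hnext : ∀ j, t' ((k :: q) ++ [j]) =
            (cs.mapIdx fun j e => g ((k :: q) ++ [j]) e)[j]? := by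
          intro j
          have := hcs j
          simp only [List.cons_append] at this ⊢
          rw [t'_lt _ _ hk, this]
          simp
        cases y₁ with
        | inl x =>
          obtain rfl : cs = [] := hstep
          obtain rfl : Sum.inl _ = y := congrArg Prod.snd hg
          exact ⟨_, rfl, hnext⟩
        | inr b =>
          obtain rfl : Sum.inr b = y := congrArg Prod.snd hg
          refine ⟨_, hrel (k :: q) cs _ b b hcs hstep (A.refl b) ?_ ?_, hnext⟩
          · intro c d
            simp only [List.mem_mapIdx]
            constructor
            · rintro ⟨k, hk, hkk⟩
              rcases hy : cs[k] with ⟨c', y⟩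
              rw [hy] at hkk
              cases y with
              | inl y => simp [g] at hkk
              | inr y =>
                simp [g] at hkk
                obtain ⟨rfl, rfl⟩ := hkk
                exact hy ▸ List.getElem_mem hk
            · intro hd
              obtain ⟨k, hk, hkk⟩ := List.getElem_of_mem hd
              exact ⟨k, hk, by rw [hkk]; rfl⟩
          · intro j c x hj
            obtain ⟨hk', hkk⟩ := List.getElem?_eq_some_iff.1 hj
            simp only [List.mem_mapIdx]
            exact ⟨j, hk', by rw [hkk]; rfl⟩
      · cases q with
        | nil =>
          rw [t'_ge k hk] at hp
          obtain ⟨e, -, hg⟩ := Option.map_eq_some_iff.1 hp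
          obtain rfl : Sum.inl _ = y := congrArg Prod.snd hg
          exact ⟨[], rfl, fun j => by simp [t'_none _ _ _ hk]⟩
        | cons k' q => rw [t'_none _ _ _ hk] at hp; simp at hp
  · -- no nodes below missing nodes
    intro p k hp
    cases p with
    | nil => cases hp
    | cons j q =>
      by_cases hj : j < cs₀.length
      · rw [t'_lt j q hj] at hp
        have := ht.none_of_none (j :: q) k (Option.map_eq_none_iff.1 hp)
        simp only [List.cons_append] at this ⊢
        rw [t'_lt _ _ hj, this]; rfl
      · cases q <;> exact t'_none _ _ _ hj
  · -- branches
    intro f hf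
    have hpre : ∀ n, prefixAt f (n + 1) = f 0 :: (List.range n).map (fun i => f (i + 1)) := by
      intro n
      simp [prefixAt, List.range_succ_eq_map, Function.comp_def]
    have hf0 : f 0 < cs₀.length := by
      by_contra hlt
      refine hf 2 ?_
      rw [hpre]
      exact t'_none _ _ _ hlt
    have hcolf : ∀ n, colourAt t' (prefixAt f n) = colourAt t (prefixAt f n) := by
      intro n
      apply hcol
      cases n with
      | zero => exact .inl rfl
      | succ n => exact .inr ⟨_, _, hpre n, hf0⟩
    simp only [hcolf]
    apply hwin f
    intro n hn
    cases n with
    | zero =>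
      have := ht.root_eq
      rw [show prefixAt f 0 = [] from rfl, this] at hn
      cases hn
    | succ n =>
      refine hf (n + 1) ?_
      rw [hpre] at hn ⊢
      rw [t'_lt _ _ hf0, hn]; rfl
  · -- leaves
    rintro ⟨c, x⟩
    constructor
    · intro hx
      obtain ⟨j, hj⟩ := List.mem_iff_getElem?.1 (Finset.mem_toList.2 hx)
      have h1 : t' [cs₀.length + j] = some (c, .inl x) := by
        rw [t'_ge _ (by omega), Nat.add_sub_cancel_left, hj]; rfl
      refine ⟨[cs₀.length + j], c, h1, ?_⟩
      simp [pathColour, Finset.range_add_one, colourAt, h1, t'_nil]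
    · rintro ⟨p, c', hp, hc⟩
      dsimp only at hp hc
      cases p with
      | nil => cases hp
      | cons k q =>
        by_cases hk : k < cs₀.length
        · rw [hpath k q hk] at hc
          rw [t'_lt k q hk] at hp
          obtain ⟨⟨c₁, y₁⟩, hy₁, hg⟩ := Option.map_eq_some_iff.1 hp
          cases y₁ with
          | inr b => simp [g] at hg
          | inl x₁ =>
            simp [g] at hg
            rw [← hg.2, hc]
            exact (hφ _ _ (hleaf _ _ _ hy₁)).2
        · cases q with
          | cons k' q => rw [t'_none _ _ _ hk] at hp; simp at hp
          | nil =>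
            have hpk := hp
            rw [t'_ge k hk] at hp
            obtain ⟨e, he, hg⟩ := Option.map_eq_some_iff.1 hp
            have hmem := Finset.mem_toList.1 (List.mem_of_getElem? he)
            simp at hg
            have hcc : c = c' := by
              rw [hc]
              simp [pathColour, Finset.range_add_one, colourAt, hpk, t'_nil]
            rw [hcc, ← hg.1, ← hg.2]
            exact hmem

/-- The fixpoint operator, from `R : !□X ⊗ !□A → A` to a morphism `!□X → A`. -/
def Mor.fixpoint (win : (ℕ → C) → Prop) {X A : Obj.{u}}
    (R : Mor ((X.cbang C).tensor (A.cbang C)) A) : Mor (X.cbang C) A where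
  rel := fixRel win R
  closed := fixRel_closed win R

end Trees

/-! ### Alternating parity automata -/

/-- An alternating parity tree automaton with states `Q` over the ranked alphabet `(Sig, ar)`:
`δ q a` is the finite set of conjunctive clauses of the transition formula, a clause being a finite
set of pairs (direction, state), and `Ω` is the colouring function. -/
structure APT (Q : Type u) {Sig : Type v} (ar : Sig → ℕ) where
  δ : Q → (a : Sig) → Finset (Finset (Fin (ar a) × Q))
  Ω : Q → ℕ

namespace APT

variable {Q : Type u} {Sig : Type v} {ar : Sig → ℕ} (𝒜 : APT Q ar)

/-- The colours `Ω(Q) ⊎ {ε}`, where the neutral colour `ε` is the added least element `⊥`. -/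
abbrev Col : Type := WithBot (Set.range 𝒜.Ω)

/-- The colour of a state, as an element of `Col`. -/
def colour (q : Q) : 𝒜.Col := ((⟨𝒜.Ω q, q, rfl⟩ : Set.range 𝒜.Ω) : WithBot (Set.range 𝒜.Ω))

/-- A sequence of colours is winning if some non-neutral colour occurs infinitely often, and the
greatest such colour is even. -/
def WinSeq (s : ℕ → 𝒜.Col) : Prop :=
  ∃ m : Set.range 𝒜.Ω, (∃ᶠ n in Filter.atTop, s n = (m : WithBot (Set.range 𝒜.Ω))) ∧
    (∀ m' : Set.range 𝒜.Ω,
      (∃ᶠ n in Filter.atTop, s n = (m' : WithBot (Set.range 𝒜.Ω))) → m' ≤ m) ∧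
    Even (m : ℕ)

/-- The tuple `α` of sets of coloured states satisfies the formula `δ q a`. -/
def Satisfies (q : Q) (a : Sig) (α : Fin (ar a) → Finset (𝒜.Col × Q)) : Prop :=
  ∃ J : Fin (ar a) → Finset (𝒜.Col × Q), (∀ k, J k ⊆ α k) ∧
    (∃ φ ∈ 𝒜.δ q a, ∀ k q', (k, q') ∈ φ ↔ ∃ c, (c, q') ∈ J k) ∧
    ∀ k c q', (c, q') ∈ J k → c = 𝒜.colour q'

/-! ### Interpretation of λY-terms -/

/-- The interpretation of simple types. -/
def sem : Ty → Obj.{u}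
  | .o => ⟨Q, (· = ·), fun _ => rfl, fun h h' => h.trans h'⟩
  | .arr σ τ => ((sem σ).cbang 𝒜.Col).lolli (sem τ)

/-- The interpretation `⟦σ₁⟧ & ⋯ & ⟦σₙ⟧` of a context as an object of the Kleisli category. -/
def semCtx : List Ty → Obj.{u}
  | [] => Obj.top
  | σ :: Γ => (semCtx Γ).prod (𝒜.sem σ)

/-- The injection of the component of the variable `x` in `⟦σ₁⟧ & ⋯ & ⟦σₙ⟧`. -/
def inj : {Γ : List Ty} → {σ : Ty} → Var Γ σ → (𝒜.sem σ).carrier → (𝒜.semCtx Γ).carrier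
  | _, _, .zero, a => Sum.inr a
  | _, _, .succ x, a => Sum.inl (inj x a)

theorem inj_le : ∀ {Γ : List Ty} {σ : Ty} (x : Var Γ σ) {a b : (𝒜.sem σ).carrier},
    (𝒜.sem σ).le a b → (𝒜.semCtx Γ).le (𝒜.inj x a) (𝒜.inj x b)
  | _, _, .zero, _, _, h => Sum.LiftRel.inr h
  | _, _, .succ x, _, _, h => Sum.LiftRel.inl (inj_le x h)

/-- The projection `⟦σ₁⟧ & ⋯ & ⟦σₙ⟧ → ⟦σ⟧` on the component of a variable. -/
def proj {Γ : List Ty} {σ : Ty} (x : Var Γ σ) : Mor (𝒜.semCtx Γ) (𝒜.sem σ) where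
  rel y a := ∃ a', y = 𝒜.inj x a' ∧ (𝒜.sem σ).le a a'
  closed := by
    rintro y y' a b ⟨a', rfl, h⟩ hy hb
    suffices H : ∀ {Γ : List Ty} {σ : Ty} (x : Var Γ σ) (a' : (𝒜.sem σ).carrier)
        (y' : (𝒜.semCtx Γ).carrier), (𝒜.semCtx Γ).le (𝒜.inj x a') y' →
        ∃ a'', y' = 𝒜.inj x a'' ∧ (𝒜.sem σ).le a' a'' by
      obtain ⟨a'', rfl, h'⟩ := H x a' y' hy
      exact ⟨a'', rfl, Obj.trans _ hb (Obj.trans _ h h')⟩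
    intro Γ σ x
    induction x with
    | zero =>
      intro a' y' h
      cases h with
      | inr h => exact ⟨_, rfl, h⟩
    | succ x ih =>
      intro a' y' h
      cases h with
      | inl h =>
        obtain ⟨a'', rfl, h'⟩ := ih _ _ h
        exact ⟨a'', rfl, h'⟩

/-- The element `(α₁, …, αₙ, q)` of `⟦o → ⋯ → o → o⟧`. -/
def conElt : (n : ℕ) → (Fin n → Finset (𝒜.Col × Q)) → Q → (𝒜.sem (Ty.ofArity n)).carrier
  | 0, _, q => q
  | n + 1, α, q => (α 0, conElt n (fun i => α i.succ) q)

theorem conElt_le : ∀ (n : ℕ) (α : Fin n → Finset (𝒜.Col × Q)) (q : Q)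
    (b : (𝒜.sem (Ty.ofArity n)).carrier), (𝒜.sem (Ty.ofArity n)).le b (𝒜.conElt n α q) →
    ∃ β : Fin n → Finset (𝒜.Col × Q), (∀ i, α i ⊆ β i) ∧ b = 𝒜.conElt n β q
  | 0, _, _, _, h => ⟨Fin.elim0, fun i => i.elim0, h⟩
  | n + 1, α, q, b, h => by
    obtain ⟨β, hβ, hb⟩ := conElt_le n (fun i => α i.succ) q b.2 h.2
    refine ⟨Fin.cons b.1 β, ?_, ?_⟩
    · intro i
      refine Fin.cases ?_ (fun i => ?_) i
      · intro e he
        obtain ⟨e', he', hc, hq⟩ := h.1 e he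
        have : e = e' := Prod.ext hc hq
        subst this
        exact he'
      · exact hβ i
    · exact Prod.ext rfl hb

/-- The interpretation of a constructor `a`, precomposed with the weakening `!□⟦Γ⟧ → 1`. -/
def semCon (Γ : List Ty) (a : Sig) :
    Mor ((𝒜.semCtx Γ).cbang 𝒜.Col) (𝒜.sem (Ty.ofArity (ar a))) where
  rel _ s := ∃ α q, s = 𝒜.conElt (ar a) α q ∧ 𝒜.Satisfies q a α
  closed := by
    rintro _ _ s s' ⟨α, q, rfl, J, hJ, h⟩ - hs
    obtain ⟨β, hβ, rfl⟩ := 𝒜.conElt_le _ _ _ _ hs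
    exact ⟨β, q, rfl, J, fun k => (hJ k).trans (hβ k), h⟩

/-- Interpretation of terms in the Kleisli category of `!□`. -/
def semTm : {Γ : List Ty} → {σ : Ty} → Tm ar Γ σ →
    Mor ((𝒜.semCtx Γ).cbang 𝒜.Col) (𝒜.sem σ)
  | Γ, _, .var x => (Mor.der 𝒜.Col (𝒜.semCtx Γ)).comp (𝒜.proj x)
  | Γ, _, .con a => 𝒜.semCon Γ a
  | Γ, .arr σ _, .lam M =>
      ((Mor.seely 𝒜.Col (𝒜.semCtx Γ) (𝒜.sem σ)).comp (semTm M)).curry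
  | Γ, τ, .app (σ := σ) M N =>
      ((Mor.contr 𝒜.Col (𝒜.semCtx Γ)).comp
        ((semTm M).tensor
          ((Mor.dig 𝒜.Col (𝒜.semCtx Γ)).comp (Mor.cbang 𝒜.Col (semTm N))))).comp
        (Mor.ev ((𝒜.sem σ).cbang 𝒜.Col) (𝒜.sem τ))
  | _, _, .fix M => Mor.fixpoint 𝒜.WinSeq (semTm M).uncurry

/-- The object `!□⟦σ₁⟧ ⊗ ⋯ ⊗ !□⟦σₙ⟧`: tuples `(u₁, …, uₙ)` indexed by the variables. -/
def env (Γ : List Ty) : Obj.{u} where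
  carrier := ∀ σ, Var Γ σ → Finset (𝒜.Col × (𝒜.sem σ).carrier)
  le ρ ρ' := ∀ σ x, ((𝒜.sem σ).cbang 𝒜.Col).le (ρ σ x) (ρ' σ x)
  refl _ _ _ := Obj.refl _ _
  trans h h' σ x := Obj.trans _ (h σ x) (h' σ x)

/-- The Seely isomorphism `!□⟦σ₁⟧ ⊗ ⋯ ⊗ !□⟦σₙ⟧ → !□(⟦σ₁⟧ & ⋯ & ⟦σₙ⟧)`. -/
def seelyCtx (Γ : List Ty) : Mor (𝒜.env Γ) ((𝒜.semCtx Γ).cbang 𝒜.Col) where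
  rel ρ w := ∀ e ∈ w, ∃ σ, ∃ x : Var Γ σ, ∃ a, (e.1, a) ∈ ρ σ x ∧
    (𝒜.semCtx Γ).le e.2 (𝒜.inj x a)
  closed := by
    rintro ρ ρ' w w' h hρ hw e he
    obtain ⟨e₁, he₁, hc, hle⟩ := hw e he
    obtain ⟨σ, x, a, ha, hle'⟩ := h e₁ he₁
    obtain ⟨⟨c, a'⟩, ha', hc', hle''⟩ := hρ σ x _ ha
    obtain rfl : e₁.1 = c := hc'
    refine ⟨σ, x, a', ?_, Obj.trans _ hle (Obj.trans _ hle' (𝒜.inj_le x hle''))⟩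
    rw [hc]; exact ha'

/-- The interpretation `⟦Γ ⊢ t :: τ⟧ : !□⟦σ₁⟧ ⊗ ⋯ ⊗ !□⟦σₙ⟧ → ⟦τ⟧`. -/
def interp {Γ : List Ty} {τ : Ty} (t : Tm ar Γ τ) : Mor (𝒜.env Γ) (𝒜.sem τ) :=
  (𝒜.seelyCtx Γ).comp (𝒜.semTm t)

/-! ### The coloured intersection type system -/

/-- The assignment of a set of coloured intersection types to each variable of `Γ`. -/
abbrev Env (Γ : List Ty) : Type u := (𝒜.env Γ).carrier

/-- Extension `Γ, x : u`. -/
def Env.cons {𝒜 : APT Q ar} {Γ : List Ty} {σ : Ty} (ρ : 𝒜.Env Γ)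
    (u : Finset (𝒜.Col × (𝒜.sem σ).carrier)) : 𝒜.Env (σ :: Γ)
  | _, .zero => u
  | _, .succ x => ρ _ x

open Classical in
/-- The set `{(max c cᵢ, αᵢ)}` obtained from `{(cᵢ, αᵢ)}`. -/
noncomputable def recolour {A : Type u} (c : 𝒜.Col) (u : Finset (𝒜.Col × A)) :
    Finset (𝒜.Col × A) :=
  u.image fun e => (max c e.1, e.2)

open Classical in
/-- The context `Γ₀ ∪ □_{c₁} Γ₁ ∪ ⋯ ∪ □_{cₙ} Γₙ`. -/
noncomputable def Env.join {𝒜 : APT Q ar} {Γ : List Ty} (ρ₀ : 𝒜.Env Γ) {n : ℕ}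
    (c : Fin n → 𝒜.Col) (ρ : Fin n → 𝒜.Env Γ) : 𝒜.Env Γ :=
  fun σ x => ρ₀ σ x ∪ Finset.univ.biUnion fun i => 𝒜.recolour (c i) (ρ i σ x)

open Classical in
/-- The intersection type `{(c₁, β₁), …, (cₙ, βₙ)} → α`. -/
noncomputable def arrow {σ τ : Ty} {n : ℕ} (c : Fin n → 𝒜.Col)
    (β : Fin n → (𝒜.sem σ).carrier) (α : (𝒜.sem τ).carrier) : (𝒜.sem (.arr σ τ)).carrier :=
  (Finset.univ.image fun i => (c i, β i), α)

/-- Sequents `x₁ : u₁ :: σ₁, …, xₙ : uₙ :: σₙ ⊢ t : α :: τ`. -/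
structure Sequent where
  ctx : List Ty
  type : Ty
  term : Tm ar ctx type
  env : 𝒜.Env ctx
  elt : (𝒜.sem type).carrier

/-- The typing rules: `RuleAt t ρ α ps` says that the sequent `ρ ⊢ t : α` is the conclusion of an
instance of a rule whose premises, with their colours, are `ps`. The rules for variables and
constructors hold in an arbitrary context (weakening). -/
def RuleAt : {Γ : List Ty} → {τ : Ty} → Tm ar Γ τ → 𝒜.Env Γ → (𝒜.sem τ).carrier →
    List (𝒜.Col × 𝒜.Sequent) → Prop
  | _, τ, .var x, ρ, α, ps => ps = [] ∧ ∃ α', (⊥, α') ∈ ρ τ x ∧ (𝒜.sem τ).le α α'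
  | _, _, .con a, _, s, ps => ps = [] ∧ ∃ α q, s = 𝒜.conElt (ar a) α q ∧ 𝒜.Satisfies q a α
  | Γ, .arr σ τ, .lam M, ρ, α, ps => ps = [(⊥, ⟨σ :: Γ, τ, M, ρ.cons α.1, α.2⟩)]
  | Γ, τ, .app (σ := σ) M N, ρ, α, ps =>
      ∃ (n : ℕ) (c : Fin n → 𝒜.Col) (β : Fin n → (𝒜.sem σ).carrier)
        (ρ₀ : 𝒜.Env Γ) (ρ' : Fin n → 𝒜.Env Γ), ρ = ρ₀.join c ρ' ∧
        ps = (⊥, ⟨Γ, .arr σ τ, M, ρ₀, 𝒜.arrow c β α⟩) ::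
          List.ofFn fun i => (⊥, ⟨Γ, σ, N, ρ' i, β i⟩)
  | Γ, σ, .fix M, ρ, α, ps =>
      ∃ (n : ℕ) (c : Fin n → 𝒜.Col) (β : Fin n → (𝒜.sem σ).carrier)
        (ρ₀ : 𝒜.Env Γ) (ρ' : Fin n → 𝒜.Env Γ), ρ = ρ₀.join c ρ' ∧
        ps = (⊥, ⟨Γ, .arr σ σ, M, ρ₀, 𝒜.arrow c β α⟩) ::
          List.ofFn fun i => (c i, ⟨Γ, σ, .fix M, ρ' i, β i⟩)

/-- The typing rules, as a relation between a sequent and the list of coloured premises. -/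
def Rule (s : 𝒜.Sequent) (ps : List (𝒜.Col × 𝒜.Sequent)) : Prop :=
  𝒜.RuleAt s.term s.env s.elt ps

/-- The sequent has a winning, possibly infinite, derivation tree. -/
def HasWinningDerivation (s : 𝒜.Sequent) : Prop :=
  ∃ D : List ℕ → Option (𝒜.Col × 𝒜.Sequent), IsTree 𝒜.Rule (⊥, s) D ∧ TreeWins 𝒜.WinSeq D

end APT

end ColScott

/-!
A winning condition which ignores finite prefixes makes winning trees coinductive up to grafting: a
branch of a tree built from a coalgebra and from given winning trees either stays in the coalgebra
or has a tail in one of these trees. Two notions of winning tree are thus compared by simulating one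
local step by another.

The set of leaves of a run-tree, and the splitting of the context in an application or a fixpoint,
are turned into local conditions by residuation. Raising the colours of a set to at least `c` has a
right adjoint, the residual at `c`; there are finitely many colours below a given one, so residuals
of finite sets are finite. It is enough to give each child of colour `c` the whole residual at `c`
of what is available at its parent, since whatever can be proved from less can be proved from more.
In this form, the only difference between a run-tree of the interpretation of `M` and the part of a
derivation of `Y M` made of the sequents on `Y M` is that the latter comes with a derivation for `M`
at each node, to which the induction hypothesis applies.
-/

namespace ColScott

/-! ### Winning trees from coalgebras -/

section Unfold

variable {C : Type} {L S : Type*}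

/-- The unfolding of the coalgebra `next` from the coloured state `e`, in the encoding of trees by
addresses. -/
def unfold (next : S → List (C × S)) (e : C × S) (p : List ℕ) : Option (C × S) :=
  p.foldlM (fun e k => (next e.2)[k]?) e

theorem unfold_concat (next : S → List (C × S)) (e : C × S) (p : List ℕ) (k : ℕ) :
    unfold next e (p ++ [k]) = (unfold next e p).bind fun e' => (next e'.2)[k]? := by
  simp [unfold, List.foldlM_append]

theorem isTree_unfold {step : L → List (C × L) → Prop} {next : S → List (C × S)} {lab : S → L}
    (hnext : ∀ s, step (lab s) ((next s).map (Prod.map id lab))) (e : C × S) :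
    IsTree step (Prod.map id lab e) fun p => (unfold next e p).map (Prod.map id lab) where
  root_eq := rfl
  children p c x hp := by
    obtain ⟨⟨_, s⟩, hs, ⟨⟩⟩ := Option.map_eq_some_iff.1 hp
    exact ⟨_, hnext s, fun k => by simp [unfold_concat, hs]⟩
  none_of_none p k hp := by
    simp [unfold_concat, Option.map_eq_none_iff.1 hp]

end Unfold

theorem prefixAt_succ (f : ℕ → ℕ) (n : ℕ) : prefixAt f (n + 1) = prefixAt f n ++ [f n] := by
  simp [prefixAt, List.range_succ]

theorem prefixAt_succ_cons (f : ℕ → ℕ) (n : ℕ) :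
    prefixAt f (n + 1) = f 0 :: prefixAt (fun i => f (i + 1)) n := by
  simp [prefixAt, List.range_succ_eq_map, Function.comp_def]

/-- Winning conditions on infinite sequences which do not depend on finite prefixes. -/
def TailInvariant {C : Type} (win : (ℕ → C) → Prop) : Prop :=
  ∀ (s : ℕ → C) (k : ℕ), win (fun n => s (n + k)) ↔ win s

/-- Every infinite path of the graph `E`, whose edges are coloured in `C`, is winning. -/
def PathsWin {C : Type} {S : Type*} (win : (ℕ → C) → Prop) (E : S → C → S → Prop) : Prop :=
  ∀ (s : ℕ → S) (c : ℕ → C), (∀ n, E (s n) (c n) (s (n + 1))) → win c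

/-- The disjoint union of two coloured graphs, with all the edges from the first to the second. -/
inductive SumEdge {C : Type} {S₁ S₂ : Type*} (E₁ : S₁ → C → S₁ → Prop) (E₂ : S₂ → C → S₂ → Prop) :
    S₁ ⊕ S₂ → C → S₁ ⊕ S₂ → Prop
  | inl {s c s'} : E₁ s c s' → SumEdge E₁ E₂ (.inl s) c (.inl s')
  | cross {s c s'} : SumEdge E₁ E₂ (.inl s) c (.inr s')
  | inr {s c s'} : E₂ s c s' → SumEdge E₁ E₂ (.inr s) c (.inr s')

theorem PathsWin.sum {C : Type} {S₁ S₂ : Type*} {win : (ℕ → C) → Prop} (hwin : TailInvariant win)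
    {E₁ : S₁ → C → S₁ → Prop} {E₂ : S₂ → C → S₂ → Prop} (h₁ : PathsWin win E₁)
    (h₂ : PathsWin win E₂) : PathsWin win (SumEdge E₁ E₂) := by
  intro s c hs
  by_cases hinl : ∀ n, ∃ x, s n = .inl x
  · choose x hx using hinl
    refine h₁ x c fun n => ?_
    have hn := hs n
    rw [hx, hx] at hn
    cases hn with
    | inl h => exact h
  · obtain ⟨N, hN⟩ := not_forall.1 hinl
    have hinr : ∀ n, ∃ y, s (n + N) = .inr y := by
      intro n
      induction n with
      | zero =>
        cases hsN : s N with
        | inl x => exact absurd ⟨x, hsN⟩ hN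
        | inr y => exact ⟨y, by rw [Nat.zero_add, hsN]⟩
      | succ n ih =>
        obtain ⟨y, hy⟩ := ih
        have hn := hs (n + N)
        rw [hy, Nat.add_right_comm] at hn
        cases hs' : s (n + 1 + N) with
        | inl x => rw [hs'] at hn; nomatch hn
        | inr y' => exact ⟨y', rfl⟩
    choose y hy using hinr
    refine (hwin c N).1 (h₂ y _ fun n => ?_)
    have hn := hs (n + N)
    rw [Nat.add_right_comm, hy, hy] at hn
    cases hn with
    | inr h => exact h

section HasWinTree

variable {C : Type} [LinearOrder C] [OrderBot C] {win : (ℕ → C) → Prop} {L : Type*}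
  {step : L → List (C × L) → Prop}

/-- There is a winning tree whose root has label `x` and the neutral colour. -/
def HasWinTree (step : L → List (C × L) → Prop) (win : (ℕ → C) → Prop) (x : L) : Prop :=
  ∃ t, IsTree step (⊥, x) t ∧ TreeWins win t

theorem treeWins_unfold {S : Type*} (hwin : TailInvariant win) {E : S → C → S → Prop}
    (hE : PathsWin win E) {next : S → List (C × S)} (hnext : ∀ s, ∀ e ∈ next s, E s e.1 e.2)
    (lab : S → L) (e : C × S) :
    TreeWins win fun p => (unfold next e p).map (Prod.map id lab) := by
  intro f hf
  have hnode : ∀ n, ∃ e', unfold next e (prefixAt f n) = some e' := fun n =>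
    Option.ne_none_iff_exists'.1 fun h => hf n (by simp [h])
  choose e' he' using hnode
  have hedge : ∀ n, E (e' n).2 (e' (n + 1)).1 (e' (n + 1)).2 := by
    intro n
    have hn := he' (n + 1)
    rw [prefixAt_succ, unfold_concat, he', Option.bind_some] at hn
    exact hnext _ _ (List.mem_of_getElem? hn)
  have hcolour : (fun n => colourAt (fun p => (unfold next e p).map (Prod.map id lab))
      (prefixAt f n)) = fun n => (e' n).1 := by
    funext n
    simp [colourAt, he']
  rw [hcolour]
  exact (hwin _ 1).1 (hE _ _ hedge)

theorem HasWinTree.of_coalgebra {S : Type*} (hwin : TailInvariant win) {E : S → C → S → Prop}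
    (hE : PathsWin win E) (lab : S → L)
    (hstep : ∀ s, ∃ cs, step (lab s) cs ∧ ∀ e ∈ cs, ∃ s', lab s' = e.2 ∧ E s e.1 s') (s : S) :
    HasWinTree step win (lab s) := by
  have hnext : ∀ s, ∃ es : List (C × S), step (lab s) (es.map (Prod.map id lab)) ∧
      ∀ e ∈ es, E s e.1 e.2 := by
    intro s
    obtain ⟨cs, hcs, hE'⟩ := hstep s
    have hmem : cs ∈ Set.range (List.map fun e : {e : C × S // E s e.1 e.2} =>
        Prod.map id lab e.1) := by
      rw [Set.range_list_map]
      intro e he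
      obtain ⟨s', hs', hEs'⟩ := hE' e he
      exact ⟨⟨(e.1, s'), hEs'⟩, Prod.ext rfl hs'⟩
    obtain ⟨es, rfl⟩ := hmem
    refine ⟨es.map Subtype.val, by simpa [Function.comp_def] using hcs, ?_⟩
    simp only [List.mem_map]
    rintro _ ⟨e, -, rfl⟩
    exact e.2
  choose next hnext hedge using hnext
  exact ⟨_, isTree_unfold hnext (⊥, s), treeWins_unfold hwin hE hedge lab (⊥, s)⟩

/-- The winning trees of `step`, with a root of arbitrary colour and label. They are the states of a
coalgebra, which maps a tree to its immediate subtrees. -/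
structure WinTree (step : L → List (C × L) → Prop) (win : (ℕ → C) → Prop) where
  root : C × L
  tree : List ℕ → Option (C × L)
  isTree : IsTree step root tree
  wins : TreeWins win tree

namespace WinTree

/-- The immediate subtree with the `k`-th child of the root as root. -/
def child (hwin : TailInvariant win) (T : WinTree step win) {k : ℕ} {e : C × L}
    (hk : T.tree [k] = some e) : WinTree step win where
  root := e
  tree q := T.tree (k :: q)
  isTree := ⟨hk, fun p => T.isTree.children (k :: p), fun p => T.isTree.none_of_none (k :: p)⟩
  wins f hf := by
    let f' : ℕ → ℕ := fun n => n.casesOn k f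
    have hf' : ∀ n, prefixAt f' (n + 1) = k :: prefixAt f n := prefixAt_succ_cons f'
    have hbranch : win fun n => colourAt T.tree (prefixAt f' n) := by
      refine T.wins f' fun n => ?_
      cases n with
      | zero => exact T.isTree.root_eq ▸ Option.some_ne_none _
      | succ n => exact hf' n ▸ hf n
    rw [← hwin _ 1] at hbranch
    simp only [hf'] at hbranch
    exact hbranch

/-- `T'` is an immediate subtree of `T`, and its root has colour `c`. -/
def Edge (T : WinTree step win) (c : C) (T' : WinTree step win) : Prop :=
  ∃ k, T'.tree = (fun q => T.tree (k :: q)) ∧ T'.root.1 = c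

theorem exists_step (hwin : TailInvariant win) (T : WinTree step win) :
    ∃ cs, step T.root.2 cs ∧
      ∀ e ∈ cs, ∃ T' : WinTree step win, T'.root.2 = e.2 ∧ T.Edge e.1 T' := by
  obtain ⟨cs, hcs, hchild⟩ := T.isTree.children [] _ _ T.isTree.root_eq
  refine ⟨cs, hcs, fun e he => ?_⟩
  obtain ⟨k, hk⟩ := List.mem_iff_getElem?.1 he
  exact ⟨T.child hwin ((hchild k).trans hk), rfl, k, rfl, rfl⟩

theorem pathsWin_edge (hwin : TailInvariant win) :
    PathsWin win (Edge (step := step) (win := win)) := by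
  intro T c hT
  choose k hk hc using hT
  have htree : ∀ n q, (T 0).tree (prefixAt k n ++ q) = (T n).tree q := by
    intro n
    induction n with
    | zero => exact fun _ => rfl
    | succ n ih => intro q; rw [prefixAt_succ, List.append_assoc, ih, hk]; rfl
  have hroot : ∀ n, (T 0).tree (prefixAt k n) = some (T n).root := by
    intro n
    rw [← (T n).isTree.root_eq, ← htree n [], List.append_nil]
  have hbranch := (T 0).wins k fun n => (hroot n).symm ▸ Option.some_ne_none _
  rw [← hwin _ 1] at hbranch
  simpa only [colourAt, hroot, Option.elim_some, hc] using hbranch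

theorem hasWinTree (hwin : TailInvariant win) (T : WinTree step win) :
    HasWinTree step win T.root.2 :=
  HasWinTree.of_coalgebra hwin (pathsWin_edge hwin) (fun T => T.root.2) (exists_step hwin) T

end WinTree

/-- Grafting: below the states of the coalgebra, arbitrary winning trees may be plugged in, since a
branch either stays in the coalgebra or has a tail in one of these trees. -/
theorem HasWinTree.of_coalgebra_or {S : Type*} (hwin : TailInvariant win) {E : S → C → S → Prop}
    (hE : PathsWin win E) (lab : S → L)
    (hstep : ∀ s, ∃ cs, step (lab s) cs ∧
      ∀ e ∈ cs, HasWinTree step win e.2 ∨ ∃ s', lab s' = e.2 ∧ E s e.1 s') (s : S) :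
    HasWinTree step win (lab s) := by
  refine HasWinTree.of_coalgebra hwin (hE.sum hwin (WinTree.pathsWin_edge (step := step) hwin))
    (Sum.elim lab fun T => T.root.2) ?_ (.inl s)
  rintro (s | T)
  · obtain ⟨cs, hcs, hgraft⟩ := hstep s
    refine ⟨cs, hcs, fun e he => ?_⟩
    obtain ⟨t, ht, hw⟩ | ⟨s', hs', hEs'⟩ := hgraft e he
    · exact ⟨.inr ⟨_, t, ht, hw⟩, rfl, .cross⟩
    · exact ⟨.inl s', hs', .inl hEs'⟩
  · obtain ⟨cs, hcs, hchild⟩ := T.exists_step hwin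
    refine ⟨cs, hcs, fun e he => ?_⟩
    obtain ⟨T', hT', hEdge⟩ := hchild e he
    exact ⟨.inr T', hT', .inr hEdge⟩

theorem hasWinTree_iff (hwin : TailInvariant win) {x : L} :
    HasWinTree step win x ↔ ∃ cs, step x cs ∧ ∀ e ∈ cs, HasWinTree step win e.2 := by
  constructor
  · rintro ⟨t, ht, hw⟩
    obtain ⟨cs, hcs, hchild⟩ := WinTree.exists_step hwin ⟨_, t, ht, hw⟩
    refine ⟨cs, hcs, fun e he => ?_⟩
    obtain ⟨T', hT', -⟩ := hchild e he
    exact hT' ▸ T'.hasWinTree hwin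
  · rintro ⟨cs, hcs, hchild⟩
    exact HasWinTree.of_coalgebra_or (E := fun _ _ _ => False) hwin (fun _ _ h => (h 0).elim)
      (fun _ : Unit => x) (fun _ => ⟨cs, hcs, fun e he => .inl (hchild e he)⟩) ()

/-- Coinduction up to grafting: the branches of the tree for `y` which never leave the simulation
carry the colours of a branch of the tree for `x`. -/
theorem HasWinTree.of_simulation {L' : Type*} {step' : L' → List (C × L') → Prop}
    (hwin : TailInvariant win) (r : L → L' → Prop)
    (hr : ∀ x y cs, r x y → step x cs → (∀ e ∈ cs, HasWinTree step win e.2) →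
      ∃ ds, step' y ds ∧ ∀ e ∈ ds, HasWinTree step' win e.2 ∨ ∃ x', (e.1, x') ∈ cs ∧ r x' e.2)
    {x : L} {y : L'} (hx : HasWinTree step win x) (hxy : r x y) : HasWinTree step' win y := by
  obtain ⟨t, ht, hw⟩ := hx
  let S := {p : WinTree step win × L' // r p.1.root.2 p.2}
  have hE : PathsWin win fun (p : S) c (p' : S) => p.1.1.Edge c p'.1.1 := fun s =>
    WinTree.pathsWin_edge hwin fun n => (s n).1.1
  refine HasWinTree.of_coalgebra_or hwin hE (fun p => p.1.2) ?_ ⟨(⟨_, t, ht, hw⟩, y), hxy⟩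
  rintro ⟨⟨T, y⟩, hTy⟩
  obtain ⟨cs, hcs, hchild⟩ := T.exists_step hwin
  have hsub : ∀ e ∈ cs, HasWinTree step win e.2 := by
    intro e he
    obtain ⟨T', hT', -⟩ := hchild e he
    exact hT' ▸ T'.hasWinTree hwin
  obtain ⟨ds, hds, hsim⟩ := hr _ _ cs hTy hcs hsub
  refine ⟨ds, hds, fun e he => (hsim e he).imp_right ?_⟩
  rintro ⟨x', hx', hrx'⟩
  obtain ⟨T', rfl, hEdge⟩ := hchild _ hx'
  exact ⟨⟨(T', e.2), hrx'⟩, rfl, hEdge⟩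

end HasWinTree

/-! ### Residuals of coloured sets -/

section Residual

variable {C : Type} [LinearOrder C] [LocallyFiniteOrderBot C]

open Classical in
/-- The greatest set which becomes a subset of `u` when all its colours are raised to at least `c`:
what a resource `u` provides below a node of colour `c`. -/
noncomputable def residual {A : Type*} (c : C) (u : Finset (C × A)) : Finset (C × A) :=
  {e ∈ u.biUnion fun e => Finset.Iic e.1 ×ˢ {e.2} | (max c e.1, e.2) ∈ u}

@[simp]
theorem mem_residual {A : Type*} {c : C} {u : Finset (C × A)} {e : C × A} :
    e ∈ residual c u ↔ (max c e.1, e.2) ∈ u := by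
  simp only [residual, Finset.mem_filter, Finset.mem_biUnion, Finset.mem_product, Finset.mem_Iic,
    Finset.mem_singleton, and_iff_right_iff_imp]
  exact fun h => ⟨_, h, le_max_right _ _, rfl⟩

theorem residual_bot [OrderBot C] {A : Type*} (u : Finset (C × A)) : residual ⊥ u = u := by
  ext
  simp

theorem residual_residual {A : Type*} (c d : C) (u : Finset (C × A)) :
    residual d (residual c u) = residual (max c d) u := by
  ext
  simp [max_assoc]

theorem residual_mono {A : Obj.{u}} (c : C) {u v : Finset (C × A.carrier)}
    (h : (A.cbang C).le u v) : (A.cbang C).le (residual c u) (residual c v) := by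
  rintro ⟨d, a⟩ ha
  obtain ⟨⟨_, a'⟩, ha', rfl, hle⟩ := h _ (mem_residual.1 ha)
  exact ⟨(d, a'), mem_residual.2 ha', rfl, hle⟩

theorem Mor.dig_rel_iff {A : Obj.{u}} {w : Finset (C × A.carrier)}
    {U : Finset (C × Finset (C × A.carrier))} :
    (Mor.dig C A).rel w U ↔ ∀ e ∈ U, (A.cbang C).le e.2 (residual e.1 w) := by
  classical
  constructor
  · rintro ⟨V, ⟨W, hW, hV⟩, hU⟩ ⟨c, u⟩ hu ⟨d, a⟩ ha
    obtain ⟨V₁, hV₁, hdist⟩ := hU _ hu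
    obtain ⟨⟨_, _, a₁⟩, h₁, rfl, rfl, hle₁⟩ := hdist _ ha
    obtain ⟨W₁, hW₁, hbox⟩ := hV V₁ hV₁
    obtain ⟨⟨_, a₂⟩, h₂, rfl, hle₂⟩ := hbox _ h₁
    obtain ⟨⟨_, a₃⟩, h₃, rfl, hle₃⟩ := hW W₁ hW₁ _ h₂
    exact ⟨(d, a₃), mem_residual.2 h₃, rfl, A.trans hle₁ (A.trans hle₂ hle₃)⟩
  · intro h
    refine ⟨U.image fun e => (residual e.1 w).image (Prod.mk e.1), ⟨{w}, ?_, ?_⟩, fun e he => ?_⟩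
    · exact fun u hu => Finset.mem_singleton.1 hu ▸ Obj.refl _ _
    · simp only [Mor.bang, Finset.forall_mem_image, Finset.mem_singleton, exists_eq_left]
      exact fun e _ d hd => ⟨_, mem_residual.1 hd, rfl, A.refl _⟩
    · refine ⟨_, Finset.mem_image_of_mem _ he, fun d hd => ?_⟩
      obtain ⟨d', hd', hle⟩ := h e he d hd
      exact ⟨_, Finset.mem_image_of_mem _ hd', rfl, hle⟩

theorem Mor.dig_comp_cbang_rel_iff {A B : Obj.{u}} (R : Mor (A.cbang C) B)
    {w : Finset (C × A.carrier)} {v : Finset (C × B.carrier)} :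
    ((Mor.dig C A).comp (Mor.cbang C R)).rel w v ↔
      ∀ e ∈ v, R.rel (residual e.1 w) e.2 := by
  classical
  constructor
  · rintro ⟨U, hU, hR⟩ ⟨c, b⟩ hb
    obtain ⟨⟨_, u⟩, hu, rfl, hrel⟩ := hR _ hb
    exact R.closed hrel (Mor.dig_rel_iff.1 hU _ hu) (B.refl b)
  · intro h
    refine ⟨v.image fun e => (e.1, residual e.1 w), Mor.dig_rel_iff.2 ?_, fun e he => ?_⟩
    · exact Finset.forall_mem_image.2 fun e _ => Obj.refl _ _
    · exact ⟨_, Finset.mem_image_of_mem _ he, rfl, h e he⟩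

end Residual

/-! ### Fixpoints -/

section PathColour

variable {C : Type} [LinearOrder C] [OrderBot C] {L : Type*} {t : List ℕ → Option (C × L)}

theorem colourAt_eq_of_eq_some {p : List ℕ} {e : C × L} (h : t p = some e) :
    colourAt t p = e.1 := by
  simp [colourAt, h]

theorem pathColour_nil (t : List ℕ → Option (C × L)) : pathColour t [] = colourAt t [] := by
  simp [pathColour]

theorem pathColour_concat (t : List ℕ → Option (C × L)) (p : List ℕ) (k : ℕ) :
    pathColour t (p ++ [k]) = max (pathColour t p) (colourAt t (p ++ [k])) := by
  unfold pathColour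
  rw [List.length_append, List.length_singleton, Finset.range_add_one, Finset.sup_insert,
    max_comm, List.take_of_length_le (by simp)]
  congr 1
  refine Finset.sup_congr rfl fun i hi => ?_
  rw [List.take_append_of_le_length (Nat.lt_succ_iff.1 (Finset.mem_range.1 hi))]

variable {L' : Type*} {t' : List ℕ → Option (C × L')}

theorem colourAt_congr (h : ∀ p, (t p).map Prod.fst = (t' p).map Prod.fst) (p : List ℕ) :
    colourAt t p = colourAt t' p := by
  have hp := h p
  unfold colourAt
  cases hc : t p <;> cases hc' : t' p <;> simp_all

theorem pathColour_congr (h : ∀ p, (t p).map Prod.fst = (t' p).map Prod.fst) (p : List ℕ) :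
    pathColour t p = pathColour t' p :=
  Finset.sup_congr rfl fun _ _ => colourAt_congr h _

theorem TreeWins.congr {win : (ℕ → C) → Prop} (hwin : TreeWins win t)
    (h : ∀ p, (t p).map Prod.fst = (t' p).map Prod.fst) : TreeWins win t' := by
  intro f hf
  simp only [← colourAt_congr h]
  refine hwin f fun n hn => hf n ?_
  simpa [hn, eq_comm] using h (prefixAt f n)

end PathColour

section Fixpoint

variable {C : Type} [LinearOrder C] {X A : Obj.{u}} {win : (ℕ → C) → Prop}
  {R : Mor ((X.cbang C).tensor (A.cbang C)) A} {w : Finset (C × X.carrier)} {a : A.carrier}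

/-- The local condition on run-trees of `R` whose nodes are moreover labelled with the greatest
colour on the path to the root, and whose leaves belong to `w`. Unlike an equation for the set of
leaves, this is a condition on each node and its children. -/
def annotatedRunStep (R : Mor ((X.cbang C).tensor (A.cbang C)) A) (w : Finset (C × X.carrier))
    (y : C × (X.carrier ⊕ A.carrier)) (cs : List (C × C × (X.carrier ⊕ A.carrier))) : Prop :=
  runStep R y.2 (cs.map (Prod.map id Prod.snd)) ∧ (∀ e ∈ cs, e.2.1 = max y.1 e.1) ∧
    ∀ x, y.2 = .inl x → (y.1, x) ∈ w

variable [OrderBot C]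

theorem IsTree.annotation_eq_pathColour {s : X.carrier ⊕ A.carrier}
    {t : List ℕ → Option (C × C × (X.carrier ⊕ A.carrier))}
    (ht : IsTree (annotatedRunStep R w) (⊥, ⊥, s) t) {p : List ℕ}
    {e : C × C × (X.carrier ⊕ A.carrier)} (he : t p = some e) : e.2.1 = pathColour t p := by
  induction p using List.reverseRecOn generalizing e with
  | nil =>
    obtain rfl := Option.some.inj (ht.root_eq.symm.trans he)
    rw [pathColour_nil, colourAt_eq_of_eq_some he]
  | append_singleton p k ih =>
    obtain ⟨⟨c, y⟩, hp⟩ := Option.ne_none_iff_exists'.1 fun h =>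
      Option.some_ne_none e (he.symm.trans (ht.none_of_none p k h))
    obtain ⟨cs, ⟨-, hannot, -⟩, hchild⟩ := ht.children _ _ _ hp
    rw [pathColour_concat, colourAt_eq_of_eq_some he, ← ih hp]
    exact hannot e (List.mem_of_getElem? ((hchild k).symm.trans he))

theorem fixRel.hasWinTree_annotatedRunStep (h : fixRel win R w a) :
    HasWinTree (annotatedRunStep R w) win (⊥, .inr a) := by
  obtain ⟨t, ht, hwins, hleaves⟩ := h
  refine ⟨fun p => (t p).map fun e => (e.1, pathColour t p, e.2), ⟨?_, ?_, ?_⟩, ?_⟩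
  · simp [ht.root_eq, pathColour_nil, colourAt_eq_of_eq_some ht.root_eq]
  · rintro p c ⟨d, s⟩ hp
    obtain ⟨⟨_, _⟩, hs, ⟨⟩⟩ := Option.map_eq_some_iff.1 hp
    obtain ⟨cs, hcs, hchild⟩ := ht.children _ _ _ hs
    refine ⟨cs.map fun e => (e.1, max (pathColour t p) e.1, e.2), ⟨?_, ?_, ?_⟩, fun k => ?_⟩
    · simpa [Function.comp_def] using hcs
    · exact List.forall_mem_map.2 fun _ _ => rfl
    · rintro x rfl
      exact (hleaves _).2 ⟨p, _, hs, rfl⟩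
    · rw [pathColour_concat, colourAt, hchild, List.getElem?_map]
      cases cs[k]? <;> rfl
  · exact fun p k hp => by simp [ht.none_of_none p k (Option.map_eq_none_iff.1 hp)]
  · exact hwins.congr fun p => by simp [Function.comp_def]

theorem fixRel.of_hasWinTree_annotatedRunStep
    (h : HasWinTree (annotatedRunStep R w) win (⊥, .inr a)) : fixRel win R w a := by
  obtain ⟨t, ht, hwins⟩ := h
  let t' : List ℕ → Option (C × (X.carrier ⊕ A.carrier)) :=
    fun p => (t p).map (Prod.map id Prod.snd)
  have hcolour : ∀ p, (t p).map Prod.fst = (t' p).map Prod.fst := fun p => by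
    simp [t', Function.comp_def]
  have ht' : IsRunTree R a t' := by
    refine ⟨by simp [t', ht.root_eq], fun p c s hp => ?_, fun p k hp => ?_⟩
    · obtain ⟨⟨_, _, _⟩, he, ⟨⟩⟩ := Option.map_eq_some_iff.1 hp
      obtain ⟨cs, ⟨hcs, -⟩, hchild⟩ := ht.children _ _ _ he
      exact ⟨_, hcs, fun k => by simp [t', hchild]⟩
    · simp [t', ht.none_of_none p k (Option.map_eq_none_iff.1 hp)]
  have hleaves : leaves t' ⊆ w := by
    rintro ⟨_, x⟩ ⟨p, c, hp, rfl⟩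
    obtain ⟨⟨_, d, _⟩, he, ⟨⟩⟩ := Option.map_eq_some_iff.1 hp
    obtain ⟨cs, ⟨-, -, hleaf⟩, -⟩ := ht.children _ _ _ he
    rw [← pathColour_congr hcolour, ← ht.annotation_eq_pathColour he]
    exact hleaf x rfl
  have hfin : (leaves t').Finite := w.finite_toSet.subset hleaves
  have hfix : fixRel win R hfin.toFinset a :=
    ⟨t', ht', hwins.congr hcolour, fun e => hfin.mem_toFinset⟩
  exact fixRel_closed win R hfix
    (fun e he => ⟨e, hleaves (hfin.mem_toFinset.1 he), Obj.refl _ _⟩) (A.refl a)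

theorem fixRel_iff_hasWinTree_annotatedRunStep :
    fixRel win R w a ↔ HasWinTree (annotatedRunStep R w) win (⊥, .inr a) :=
  ⟨fixRel.hasWinTree_annotatedRunStep, fixRel.of_hasWinTree_annotatedRunStep⟩

variable [LocallyFiniteOrderBot C]

/-- The local condition on run-trees of `R` without leaves in `X`: a node is labelled with the set
of all the leaves which it may use, and passes on to a child of colour `c` the residual of this set
at `c`. -/
def residualRunStep (R : Mor ((X.cbang C).tensor (A.cbang C)) A)
    (y : Finset (C × X.carrier) × A.carrier)
    (cs : List (C × Finset (C × X.carrier) × A.carrier)) : Prop :=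
  ∃ v : Finset (C × A.carrier), R.rel (y.1, v) y.2 ∧
    cs = v.toList.map fun e => (e.1, residual e.1 y.1, e.2)

theorem HasWinTree.residualRunStep_of_annotatedRunStep (hwin : TailInvariant win)
    (h : HasWinTree (annotatedRunStep R w) win (⊥, .inr a)) :
    HasWinTree (residualRunStep R) win (w, a) := by
  refine h.of_simulation hwin (fun y z => ∃ d b, y = (d, .inr b) ∧ z = (residual d w, b)) ?_
    ⟨⊥, a, rfl, by rw [residual_bot]⟩
  rintro _ _ cs ⟨d, b, rfl, rfl⟩ ⟨⟨u, v, hu, hv, hR⟩, hannot, -⟩ hsub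
  have hchild : ∀ {c s}, (c, s) ∈ cs.map (Prod.map id Prod.snd) → (c, max d c, s) ∈ cs := by
    intro c s hs
    obtain ⟨⟨c, d', s⟩, he, ⟨⟩⟩ := List.mem_map.1 hs
    obtain rfl : d' = max d c := hannot _ he
    exact he
  have hleaf : ∀ e ∈ u, e ∈ residual d w := by
    rintro ⟨c, x⟩ hx
    obtain ⟨_, ⟨-, -, hw⟩, -⟩ := (hasWinTree_iff hwin).1 (hsub _ (hchild ((hu c x).1 hx)))
    exact mem_residual.2 (hw x rfl)
  refine ⟨_, ⟨v, R.closed hR ⟨fun e he => ⟨e, hleaf e he, Obj.refl _ _⟩, Obj.refl _ _⟩ (A.refl b),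
    rfl⟩, ?_⟩
  simp only [List.mem_map, Finset.mem_toList]
  rintro _ ⟨⟨c, b'⟩, hb', rfl⟩
  exact .inr ⟨_, hchild ((hv c b').1 hb'), max d c, b', rfl, by rw [residual_residual]⟩

theorem HasWinTree.annotatedRunStep_of_residualRunStep (hwin : TailInvariant win)
    (h : HasWinTree (residualRunStep R) win (w, a)) :
    HasWinTree (annotatedRunStep R w) win (⊥, .inr a) := by
  refine h.of_simulation hwin (fun z y => ∃ d b, y = (d, .inr b) ∧ z = (residual d w, b)) ?_
    ⟨⊥, a, rfl, by rw [residual_bot]⟩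
  rintro _ _ _ ⟨d, b, rfl, rfl⟩ ⟨v, hR, rfl⟩ -
  refine ⟨((residual d w).toList.map fun e => (e.1, max d e.1, .inl e.2)) ++
    v.toList.map fun e => (e.1, max d e.1, .inr e.2),
    ⟨⟨residual d w, v, by simp, by simp, hR⟩, ?_, nofun⟩, ?_⟩
  · exact List.forall_mem_append.2
      ⟨List.forall_mem_map.2 fun _ _ => rfl, List.forall_mem_map.2 fun _ _ => rfl⟩
  simp only [List.mem_append, List.mem_map, Finset.mem_toList]
  rintro _ (⟨⟨c, x⟩, hx, rfl⟩ | ⟨⟨c, b'⟩, hb', rfl⟩)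
  · refine .inl ((hasWinTree_iff hwin).2 ⟨[], ⟨rfl, by simp, ?_⟩, by simp⟩)
    rintro _ ⟨⟩
    exact mem_residual.1 hx
  · exact .inr ⟨_, ⟨_, hb', rfl⟩, max d c, b', rfl, by rw [residual_residual]⟩

theorem fixRel_iff_hasWinTree_residualRunStep (hwin : TailInvariant win) :
    fixRel win R w a ↔ HasWinTree (residualRunStep R) win (w, a) :=
  fixRel_iff_hasWinTree_annotatedRunStep.trans
    ⟨.residualRunStep_of_annotatedRunStep hwin, .annotatedRunStep_of_residualRunStep hwin⟩

end Fixpoint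

/-! ### The interpretation of terms -/

section BoxSum

variable {C : Type}

/-- The disjoint union of two coloured sets, i.e. the Seely isomorphism `!□A × !□B ≅ !□(A & B)` on
elements. -/
def boxSum {A B : Type*} (u : Finset (C × A)) (v : Finset (C × B)) : Finset (C × (A ⊕ B)) :=
  (u.disjSum v).map (Equiv.prodSumDistrib C A B).symm.toEmbedding

@[simp]
theorem mem_boxSum_inl {A B : Type*} {u : Finset (C × A)} {v : Finset (C × B)} {c : C} {a : A} :
    (c, .inl a) ∈ boxSum u v ↔ (c, a) ∈ u := by
  simp [boxSum, Finset.mem_map_equiv]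

@[simp]
theorem mem_boxSum_inr {A B : Type*} {u : Finset (C × A)} {v : Finset (C × B)} {c : C} {b : B} :
    (c, .inr b) ∈ boxSum u v ↔ (c, b) ∈ v := by
  simp [boxSum, Finset.mem_map_equiv]

theorem Mor.seely_rel_iff {A B : Obj.{u}} {u : Finset (C × A.carrier)} {v : Finset (C × B.carrier)}
    {w : Finset (C × (A.carrier ⊕ B.carrier))} :
    (Mor.seely C A B).rel (u, v) w ↔ ((A.prod B).cbang C).le w (boxSum u v) := by
  constructor
  · rintro ⟨hA, hB⟩ ⟨c, a | b⟩ he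
    · obtain ⟨a', ha', hle⟩ := hA c a he
      exact ⟨(c, .inl a'), mem_boxSum_inl.2 ha', rfl, .inl hle⟩
    · obtain ⟨b', hb', hle⟩ := hB c b he
      exact ⟨(c, .inr b'), mem_boxSum_inr.2 hb', rfl, .inr hle⟩
  · intro h
    constructor
    · intro c a ha
      obtain ⟨⟨_, _⟩, ha', rfl, hle⟩ := h _ ha
      cases hle with
      | inl hle => exact ⟨_, mem_boxSum_inl.1 ha', hle⟩
    · intro c b hb
      obtain ⟨⟨_, _⟩, hb', rfl, hle⟩ := h _ hb
      cases hle with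
      | inr hle => exact ⟨_, mem_boxSum_inr.1 hb', hle⟩

end BoxSum

namespace APT

variable {Q : Type u} {Sig : Type v} {ar : Sig → ℕ} {𝒜 : APT Q ar}

theorem tailInvariant_winSeq : TailInvariant 𝒜.WinSeq := by
  intro s k
  have h : ∀ m : 𝒜.Col, (∃ᶠ n in Filter.atTop, s (n + k) = m) ↔
      ∃ᶠ n in Filter.atTop, s n = m := by
    intro m
    rw [← Filter.frequently_map (m := fun n => n + k) (P := fun n => s n = m),
      Filter.map_add_atTop_eq_nat]
  simp only [WinSeq, h]

noncomputable instance : LocallyFiniteOrderBot 𝒜.Col :=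
  have hfin : ∀ c : 𝒜.Col, (Set.Iic c).Finite := by
    intro c
    induction c using WithBot.recBotCoe with
    | bot => simp
    | coe m =>
      have hm : (Set.Iic m).Finite :=
        (Set.finite_Iic (m : ℕ)).preimage Subtype.val_injective.injOn
      refine ((hm.image (↑)).insert ⊥).subset fun d hd => ?_
      induction d using WithBot.recBotCoe with
      | bot => exact Set.mem_insert _ _
      | coe d => exact .inr ⟨d, WithBot.coe_le_coe.1 hd, rfl⟩
  .ofIic' _ (fun c => (hfin c).toFinset) fun _ _ => (hfin _).mem_toFinset

theorem exists_eq_inj : ∀ {Γ : List Ty} (y : (𝒜.semCtx Γ).carrier),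
    ∃ (σ : Ty) (x : Var Γ σ) (a : (𝒜.sem σ).carrier), y = 𝒜.inj x a
  | [], y => PEmpty.elim y
  | _ :: _, .inr a => ⟨_, .zero, a, rfl⟩
  | _ :: _, .inl y => by
    obtain ⟨σ, x, a, rfl⟩ := exists_eq_inj y
    exact ⟨σ, .succ x, a, rfl⟩

/-- The element `(u₁, …, uₙ)` of `!□⟦σ₁⟧ ⊗ ⋯ ⊗ !□⟦σₙ⟧` as an element of `!□(⟦σ₁⟧ & ⋯ & ⟦σₙ⟧)`. -/
def flat : {Γ : List Ty} → 𝒜.Env Γ → Finset (𝒜.Col × (𝒜.semCtx Γ).carrier)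
  | [], _ => ∅
  | _ :: _, ρ => boxSum (flat fun _ x => ρ _ (.succ x)) (ρ _ .zero)

theorem mem_flat_inj : ∀ {Γ : List Ty} {σ : Ty} {ρ : 𝒜.Env Γ} {x : Var Γ σ} {c : 𝒜.Col}
    {a : (𝒜.sem σ).carrier}, (c, 𝒜.inj x a) ∈ flat ρ ↔ (c, a) ∈ ρ σ x
  | _, _, _, .zero, _, _ => mem_boxSum_inr
  | _, _, _, .succ _, _, _ => mem_boxSum_inl.trans mem_flat_inj

theorem flat_mono {Γ : List Ty} {ρ ρ' : 𝒜.Env Γ} (h : (𝒜.env Γ).le ρ ρ') :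
    ((𝒜.semCtx Γ).cbang 𝒜.Col).le (flat ρ) (flat ρ') := by
  rintro ⟨c, y⟩ hy
  obtain ⟨σ, x, a, rfl⟩ := exists_eq_inj y
  obtain ⟨⟨_, a'⟩, ha', rfl, hle⟩ := h σ x _ (mem_flat_inj.1 hy)
  exact ⟨_, mem_flat_inj.2 ha', rfl, 𝒜.inj_le x hle⟩

theorem seelyCtx_rel_iff {Γ : List Ty} {ρ : 𝒜.Env Γ}
    {w : Finset (𝒜.Col × (𝒜.semCtx Γ).carrier)} :
    (𝒜.seelyCtx Γ).rel ρ w ↔ ((𝒜.semCtx Γ).cbang 𝒜.Col).le w (flat ρ) := by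
  constructor
  · intro h e he
    obtain ⟨σ, x, a, ha, hle⟩ := h e he
    exact ⟨_, mem_flat_inj.2 ha, rfl, hle⟩
  · rintro h ⟨c, z⟩ he
    obtain ⟨⟨_, y⟩, hy, rfl, hle⟩ := h _ he
    obtain ⟨σ, x, a, rfl⟩ := exists_eq_inj y
    exact ⟨σ, x, a, mem_flat_inj.1 hy, hle⟩

theorem interp_rel_iff {Γ : List Ty} {τ : Ty} {t : Tm ar Γ τ} {ρ : 𝒜.Env Γ}
    {α : (𝒜.sem τ).carrier} : (𝒜.interp t).rel ρ α ↔ (𝒜.semTm t).rel (flat ρ) α := by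
  constructor
  · rintro ⟨w, hw, h⟩
    exact (𝒜.semTm t).closed h (seelyCtx_rel_iff.1 hw) (Obj.refl _ _)
  · exact fun h => ⟨_, seelyCtx_rel_iff.2 (Obj.refl _ _), h⟩

theorem semTm_var_rel_iff {Γ : List Ty} {σ : Ty} {x : Var Γ σ} {ρ : 𝒜.Env Γ}
    {α : (𝒜.sem σ).carrier} : (𝒜.semTm (.var x)).rel (flat ρ) α ↔
      ∃ α', (⊥, α') ∈ ρ σ x ∧ (𝒜.sem σ).le α α' := by
  constructor
  · rintro ⟨y, ⟨⟨_, b⟩, ⟨⟨_, y'⟩, hmem, rfl, hle⟩, rfl, hyb⟩, hproj⟩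
    obtain ⟨α', rfl, hα⟩ := (𝒜.proj x).closed hproj (Obj.trans _ hyb hle) (Obj.refl _ α)
    exact ⟨α', mem_flat_inj.1 hmem, hα⟩
  · rintro ⟨α', hα', hle⟩
    exact ⟨𝒜.inj x α', ⟨_, ⟨_, mem_flat_inj.2 hα', Obj.refl _ _⟩, rfl, Obj.refl _ _⟩, α', rfl, hle⟩

theorem semTm_lam_rel_iff {Γ : List Ty} {σ τ : Ty} {M : Tm ar (σ :: Γ) τ} {ρ : 𝒜.Env Γ}
    {α : (𝒜.sem (.arr σ τ)).carrier} : (𝒜.semTm (.lam M)).rel (flat ρ) α ↔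
      (𝒜.semTm M).rel (flat (ρ.cons α.1)) α.2 := by
  constructor
  · rintro ⟨w, hw, h⟩
    exact (𝒜.semTm M).closed h (Mor.seely_rel_iff.1 hw) (Obj.refl _ _)
  · exact fun h => ⟨_, Mor.seely_rel_iff.2 (Obj.refl _ _), h⟩

theorem semTm_app_rel_iff {Γ : List Ty} {σ τ : Ty} {M : Tm ar Γ (.arr σ τ)} {N : Tm ar Γ σ}
    {w : Finset (𝒜.Col × (𝒜.semCtx Γ).carrier)} {α : (𝒜.sem τ).carrier} :
    (𝒜.semTm (.app M N)).rel w α ↔ ∃ v : Finset (𝒜.Col × (𝒜.sem σ).carrier),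
      (𝒜.semTm M).rel w (v, α) ∧ ∀ e ∈ v, (𝒜.semTm N).rel (residual e.1 w) e.2 := by
  constructor
  · rintro ⟨⟨⟨u, α'⟩, v⟩, ⟨⟨w₁, w₂⟩, ⟨hw₁, hw₂⟩, hM, hN⟩, huv, hα⟩
    refine ⟨v, (𝒜.semTm M).closed hM hw₁ ⟨huv, hα⟩, fun e he => ?_⟩
    exact (𝒜.semTm N).closed (Mor.dig_comp_cbang_rel_iff _ |>.1 hN e he) (residual_mono _ hw₂)
      (Obj.refl _ _)
  · rintro ⟨v, hM, hN⟩
    exact ⟨((v, α), v), ⟨(w, w), ⟨Obj.refl _ _, Obj.refl _ _⟩, hM,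
      (Mor.dig_comp_cbang_rel_iff _).2 hN⟩, Obj.refl _ _, Obj.refl _ _⟩

theorem semTm_fix_rel_iff {Γ : List Ty} {σ : Ty} {M : Tm ar Γ (.arr σ σ)}
    {w : Finset (𝒜.Col × (𝒜.semCtx Γ).carrier)} {α : (𝒜.sem σ).carrier} :
    (𝒜.semTm (.fix M)).rel w α ↔
      HasWinTree (residualRunStep (𝒜.semTm M).uncurry) 𝒜.WinSeq (w, α) :=
  fixRel_iff_hasWinTree_residualRunStep tailInvariant_winSeq

/-! ### The type system -/

theorem mem_recolour {A : Type u} {c : 𝒜.Col} {u : Finset (𝒜.Col × A)} {e : 𝒜.Col × A} :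
    e ∈ 𝒜.recolour c u ↔ ∃ d, (d, e.2) ∈ u ∧ max c d = e.1 := by
  simp [recolour, Prod.ext_iff]

/-- The context which provides below a node of colour `c` what `ρ` provides at this node. -/
noncomputable def Env.residual {Γ : List Ty} (c : 𝒜.Col) (ρ : 𝒜.Env Γ) : 𝒜.Env Γ :=
  fun σ x => ColScott.residual c (ρ σ x)

theorem flat_residual {Γ : List Ty} (c : 𝒜.Col) (ρ : 𝒜.Env Γ) :
    flat (ρ.residual c) = residual c (flat ρ) := by
  ext ⟨d, y⟩
  obtain ⟨σ, x, a, rfl⟩ := exists_eq_inj y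
  simp only [mem_flat_inj, Env.residual, mem_residual]

namespace Env

variable {Γ : List Ty} {n : ℕ} {c : Fin n → 𝒜.Col}

theorem mem_join {ρ₀ : 𝒜.Env Γ} {ρ : Fin n → 𝒜.Env Γ} {σ : Ty} {x : Var Γ σ}
    {e : 𝒜.Col × (𝒜.sem σ).carrier} :
    e ∈ ρ₀.join c ρ σ x ↔ e ∈ ρ₀ σ x ∨ ∃ i, e ∈ 𝒜.recolour (c i) (ρ i σ x) := by
  simp only [join, Finset.mem_union, Finset.mem_biUnion, Finset.mem_univ, true_and]

theorem le_join (ρ₀ : 𝒜.Env Γ) (c : Fin n → 𝒜.Col) (ρ : Fin n → 𝒜.Env Γ) :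
    (𝒜.env Γ).le ρ₀ (ρ₀.join c ρ) :=
  fun _ _ e he => ⟨e, mem_join.2 (.inl he), Obj.refl _ _⟩

theorem le_residual_join (ρ₀ : 𝒜.Env Γ) (c : Fin n → 𝒜.Col) (ρ : Fin n → 𝒜.Env Γ) (i : Fin n) :
    (𝒜.env Γ).le (ρ i) ((ρ₀.join c ρ).residual (c i)) :=
  fun _ _ e he => ⟨e, mem_residual.2 (mem_join.2 (.inr ⟨i, mem_recolour.2 ⟨_, he, rfl⟩⟩)),
    Obj.refl _ _⟩

theorem join_residual (ρ : 𝒜.Env Γ) (c : Fin n → 𝒜.Col) :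
    ρ.join c (fun i => ρ.residual (c i)) = ρ := by
  funext σ x
  ext ⟨d, a⟩
  simp only [mem_join, mem_recolour, or_iff_left_iff_imp]
  rintro ⟨i, d, hd, rfl⟩
  exact mem_residual.1 hd

end Env

theorem mem_arrow {σ τ : Ty} {n : ℕ} {c : Fin n → 𝒜.Col} {β : Fin n → (𝒜.sem σ).carrier}
    {α : (𝒜.sem τ).carrier} {e : 𝒜.Col × (𝒜.sem σ).carrier} :
    e ∈ (𝒜.arrow c β α).1 ↔ ∃ i, (c i, β i) = e := by
  simp [arrow]

theorem exists_arrow_eq {σ τ : Ty} (u : Finset (𝒜.Col × (𝒜.sem σ).carrier))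
    (α : (𝒜.sem τ).carrier) :
    ∃ (n : ℕ) (c : Fin n → 𝒜.Col) (β : Fin n → (𝒜.sem σ).carrier), 𝒜.arrow c β α = (u, α) := by
  refine ⟨_, fun i => (u.toList.get i).1, fun i => (u.toList.get i).2, Prod.ext ?_ rfl⟩
  ext e
  rw [mem_arrow, ← Finset.mem_toList, List.mem_iff_get]

section Rules

variable {Γ : List Ty} {σ τ : Ty}

theorem hasWinningDerivation_app_iff {M : Tm ar Γ (.arr σ τ)} {N : Tm ar Γ σ}
    (hM : ∀ ρ α, 𝒜.HasWinningDerivation ⟨Γ, _, M, ρ, α⟩ ↔ (𝒜.semTm M).rel (flat ρ) α)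
    (hN : ∀ ρ α, 𝒜.HasWinningDerivation ⟨Γ, _, N, ρ, α⟩ ↔ (𝒜.semTm N).rel (flat ρ) α)
    {ρ : 𝒜.Env Γ} {α : (𝒜.sem τ).carrier} :
    𝒜.HasWinningDerivation ⟨Γ, τ, .app M N, ρ, α⟩ ↔ (𝒜.semTm (.app M N)).rel (flat ρ) α := by
  rw [semTm_app_rel_iff]
  refine (hasWinTree_iff tailInvariant_winSeq).trans ⟨?_, ?_⟩
  · rintro ⟨_, ⟨n, c, β, (ρ₀ : 𝒜.Env Γ), (ρ' : Fin n → 𝒜.Env Γ), hρ, rfl⟩, hps⟩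
    obtain rfl : ρ = ρ₀.join c ρ' := hρ
    have hM' := (hM _ _).1 (hps _ List.mem_cons_self)
    refine ⟨(𝒜.arrow c β α).1,
      (𝒜.semTm M).closed hM' (flat_mono (ρ₀.le_join c ρ')) (Obj.refl _ _), fun e he => ?_⟩
    obtain ⟨i, rfl⟩ := mem_arrow.1 he
    have hN' := (hN _ _).1 (hps _ (List.mem_cons_of_mem _ (List.mem_ofFn.2 ⟨i, rfl⟩)))
    rw [← flat_residual]
    exact (𝒜.semTm N).closed hN' (flat_mono (ρ₀.le_residual_join c ρ' i)) (Obj.refl _ _)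
  · rintro ⟨v, hv, hvN⟩
    obtain ⟨n, c, β, hcβ⟩ := exists_arrow_eq v α
    refine ⟨_, ⟨n, c, β, ρ, fun i => ρ.residual (c i), (ρ.join_residual c).symm, rfl⟩, ?_⟩
    refine List.forall_mem_cons.2 ⟨(hM _ _).2 (hcβ ▸ hv), List.forall_mem_ofFn_iff.2 fun i => ?_⟩
    have hi : (c i, β i) ∈ v := (congrArg Prod.fst hcβ).subset (mem_arrow.2 ⟨i, rfl⟩)
    exact (hN _ _).2 (flat_residual (c i) ρ ▸ hvN _ hi)

theorem semTm_fix_rel_of_hasWinningDerivation {M : Tm ar Γ (.arr σ σ)}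
    (hM : ∀ ρ α, 𝒜.HasWinningDerivation ⟨Γ, _, M, ρ, α⟩ → (𝒜.semTm M).rel (flat ρ) α)
    {ρ : 𝒜.Env Γ} {α : (𝒜.sem σ).carrier}
    (h : 𝒜.HasWinningDerivation ⟨Γ, σ, .fix M, ρ, α⟩) : (𝒜.semTm (.fix M)).rel (flat ρ) α := by
  refine semTm_fix_rel_iff.2 (HasWinTree.of_simulation tailInvariant_winSeq
    (fun s y => ∃ ρ' b w, s = ⟨Γ, σ, .fix M, ρ', b⟩ ∧ y = (w, b) ∧
      ((𝒜.semCtx Γ).cbang 𝒜.Col).le (flat ρ') w) ?_ h ⟨ρ, α, _, rfl, rfl, Obj.refl _ _⟩)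
  rintro _ _ _ ⟨ρ', b, w, rfl, rfl, hw⟩
    ⟨n, c, β, (ρ₀ : 𝒜.Env Γ), (ρ₁ : Fin n → 𝒜.Env Γ), hρ', rfl⟩ hps
  obtain rfl : ρ' = ρ₀.join c ρ₁ := hρ'
  have hM' := hM _ _ (hps _ List.mem_cons_self)
  have hw₀ := Obj.trans _ (flat_mono (ρ₀.le_join c ρ₁)) hw
  refine ⟨_, ⟨(𝒜.arrow c β b).1, (𝒜.semTm M).closed hM' hw₀ (Obj.refl _ _), rfl⟩, ?_⟩
  simp only [List.mem_map, Finset.mem_toList]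
  rintro _ ⟨e, he, rfl⟩
  obtain ⟨i, rfl⟩ := mem_arrow.1 he
  have hwi := residual_mono (c i) hw
  rw [← flat_residual] at hwi
  exact .inr ⟨_, List.mem_cons_of_mem _ (List.mem_ofFn.2 ⟨i, rfl⟩), ρ₁ i, β i, _, rfl, rfl,
    Obj.trans _ (flat_mono (ρ₀.le_residual_join c ρ₁ i)) hwi⟩

theorem hasWinningDerivation_fix_of_semTm_rel {M : Tm ar Γ (.arr σ σ)}
    (hM : ∀ ρ α, (𝒜.semTm M).rel (flat ρ) α → 𝒜.HasWinningDerivation ⟨Γ, _, M, ρ, α⟩)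
    {ρ : 𝒜.Env Γ} {α : (𝒜.sem σ).carrier} (h : (𝒜.semTm (.fix M)).rel (flat ρ) α) :
    𝒜.HasWinningDerivation ⟨Γ, σ, .fix M, ρ, α⟩ := by
  refine HasWinTree.of_simulation tailInvariant_winSeq
    (fun y s => ∃ ρ' b, y = (flat ρ', b) ∧ s = ⟨Γ, σ, .fix M, ρ', b⟩) ?_
    (semTm_fix_rel_iff.1 h) ⟨ρ, α, rfl, rfl⟩
  rintro _ _ _ ⟨ρ', b, rfl, rfl⟩ ⟨v, hv, rfl⟩ -
  obtain ⟨n, c, β, hcβ⟩ := exists_arrow_eq v b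
  refine ⟨_, ⟨n, c, β, ρ', fun i => ρ'.residual (c i), (ρ'.join_residual c).symm, rfl⟩, ?_⟩
  refine List.forall_mem_cons.2 ⟨.inl (hM _ _ (hcβ ▸ hv)), List.forall_mem_ofFn_iff.2 fun i => ?_⟩
  have hi : (c i, β i) ∈ v := (congrArg Prod.fst hcβ).subset (mem_arrow.2 ⟨i, rfl⟩)
  exact .inr ⟨_, List.mem_map.2 ⟨_, Finset.mem_toList.2 hi, rfl⟩, ρ'.residual (c i), β i,
    by rw [flat_residual], rfl⟩

end Rules

theorem hasWinningDerivation_iff_semTm {Γ : List Ty} {τ : Ty} {t : Tm ar Γ τ}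
    {ρ : 𝒜.Env Γ} {α : (𝒜.sem τ).carrier} :
    𝒜.HasWinningDerivation ⟨Γ, τ, t, ρ, α⟩ ↔ (𝒜.semTm t).rel (flat ρ) α := by
  induction t with
  | var x =>
    rw [semTm_var_rel_iff]
    refine (hasWinTree_iff tailInvariant_winSeq).trans ⟨?_, fun h => ⟨[], ⟨rfl, h⟩, by simp⟩⟩
    rintro ⟨_, ⟨-, h⟩, -⟩
    exact h
  | con a =>
    refine (hasWinTree_iff tailInvariant_winSeq).trans ⟨?_, fun h => ⟨[], ⟨rfl, h⟩, by simp⟩⟩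
    rintro ⟨_, ⟨-, h⟩, -⟩
    exact h
  | lam M ih =>
    rw [semTm_lam_rel_iff, ← ih]
    refine (hasWinTree_iff tailInvariant_winSeq).trans ⟨?_, fun h => ⟨_, rfl, ?_⟩⟩
    · rintro ⟨_, rfl, h⟩
      exact h _ (List.mem_singleton.2 rfl)
    · exact List.forall_mem_singleton.2 h
  | app M N ihM ihN => exact hasWinningDerivation_app_iff (fun _ _ => ihM) fun _ _ => ihN
  | fix M ih =>
    exact ⟨semTm_fix_rel_of_hasWinningDerivation fun _ _ => ih.1,
      hasWinningDerivation_fix_of_semTm_rel fun _ _ => ih.2⟩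

end APT

end ColScott

theorem mainTheorem4_general {Q : Type u} {Sig : Type v} {ar : Sig → ℕ}
    (𝒜 : ColScott.APT Q ar) {Γ : List ColScott.Ty} {τ : ColScott.Ty} (t : ColScott.Tm ar Γ τ)
    (ρ : 𝒜.Env Γ) (α : (𝒜.sem τ).carrier) :
    𝒜.HasWinningDerivation ⟨Γ, τ, t, ρ, α⟩ ↔ (𝒜.interp t).rel ρ α :=
  ColScott.APT.hasWinningDerivation_iff_semTm.trans ColScott.APT.interp_rel_iff.symm

/-- A sequent has a winning derivation in the coloured intersection type system with fixpoints iff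
the corresponding tuple lies in the interpretation of the term in the coloured Scott model. -/
theorem mainTheorem4 {Q : Type u} [Finite Q] {Sig : Type v} {ar : Sig → ℕ}
    (𝒜 : ColScott.APT Q ar) {Γ : List ColScott.Ty} {τ : ColScott.Ty} (t : ColScott.Tm ar Γ τ)
    (ρ : 𝒜.Env Γ) (α : (𝒜.sem τ).carrier) :
    𝒜.HasWinningDerivation ⟨Γ, τ, t, ρ, α⟩ ↔ (𝒜.interp t).rel ρ α :=
  mainTheorem4_general 𝒜 t ρ α
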